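/- **Setting.** Let $d\in\mathbb N$ and let $\mathcal P=\{p_i\}_{i\in I}$ be a finite family of prototiles: each $p_i\subset\mathbb R^d$ carries the label $i$, is homeomorphic to the closed unit ball, and has a chosen interior point $x(p_i)$, its puncture. A tile is a labelled translate $t=p_i+y$, with puncture $x(t)=x(p_i)+y$. A tiling $T$ is a set of tiles with union $\mathbb R^d$ and pairwise disjoint interiors. Put $T\sqcap B_r(x)=\{t\in T\mid t\cap B_r(x)\neq\varnothing\}$. The distance $d(T_1,T_2)$ is the infimum of those $\varepsilon\in(0,1)$ for which there are $x_1,x_2\in\mathbb R^d$ with $\|x_1\|,\|x_2\|\le\varepsilon$ and $(T_1+x_1)\sqcap B_{1/\varepsilon}(0)=(T_2+x_2)\sqcap B_{1/\varepsilon}(0)$, and is $1$ if there are none; it is a metric on the set of all tilings with prototiles $\mathcal P$. The hull $\Omega_T$ is the completion of the orbit $T+\mathbb R^d$ in this metric, realised as the closure of the orbit among these tilings. $T$ has *finite local complexity* (FLC) if for every $R>0$ there are only finitely many $T\sqcap B_R(x)$, $x\in\mathbb R^d$, up to translation. It is *aperiodic* if for all $T'\in\Omega_T$ the equation $T'+x=T'$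 implies $x=0$. It is *repetitive* if for every finite connected set of tiles $P\subset T$ there is $R>0$ such that each $T\sqcap B_R(x)$, $x\in\mathbb R^d$, contains a translate of $P$. The discrete hull $\Omega_{\rm punc}\subset\Omega_T$ consists of the $T'\in\Omega_T$ that have a tile with puncture $0$. The tiling groupoid is $$R_{\rm punc}=\{(T',T'-x(t))\mid T'\in\Omega_{\rm punc},\ t\in T'\},$$ with $(T_1,T_2)(T_2,T_3)=(T_1,T_3)$, $(T_1,T_2)^{-1}=(T_2,T_1)$, $r(T_1,T_2)=T_1$, $s(T_1,T_2)=T_2$, unit space $\Omega_{\rm punc}$, and the metric $$d_R\big((T_1,T_1-x(t_1)),(T_2,T_2-x(t_2))\big)=d(T_1,T_2)+\|x(t_1)-x(t_2)\|.$$ Let $G$ be a locally compact Hausdorff étale groupoid. A *$G$-set* is a subset of $G$ on which $r$ and $s$ are injective. A subgroupoid $K\subset G$ is *elementary* if it is compact and, with the relative topology, an étale groupoid, contains $G^{(0)}$, and has a *fundamental domain* $F\subset K^{(0)}$, i.e. there are $n,N_1,\dots,N_n\in\mathbb N$ with $N_i\ge 1$ and clopen sets $F^{(i)}_j\subset K^{(0)}$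 ($1\le i\le n$, $1\le j\le N_i$) such that $K^{(0)}=\bigsqcup_{i,j}F^{(i)}_j$, $F=\bigsqcup_iF^{(i)}_1$, for all $i,j,k$ there is a unique compact open $K$-set $V^{(i)}_{j,k}$ with $r(V^{(i)}_{j,k})=F^{(i)}_j$ and $s(V^{(i)}_{j,k})=F^{(i)}_k$, and $K=\bigsqcup_{i,j,k}V^{(i)}_{j,k}$. For compact $C\subset G$ and $\varepsilon>0$, $K$ is *$(C,\varepsilon)$-invariant* if $|CKu\setminus Ku|<\varepsilon|Ku|$ for all $u\in G^{(0)}$, where $Ku=\{k\in K\mid s(k)=u\}$. $G$ is *almost finite* if the compact open $G$-sets cover $G$ and for all compact $C\subset G$ and $\varepsilon>0$ there is a $(C,\varepsilon)$-invariant elementary subgroupoid of $G$. **Lemma.** Let $T$ be an aperiodic and repetitive tiling with FLC. Then $R_{\rm punc}$ is a locally compact Hausdorff étale groupoid and is almost finite. Moreover, for every compact $C\subset R_{\rm punc}$ and all $\varepsilon,\delta>0$ there is a $(C,\varepsilon)$-invariant elementary subgroupoid $K$ of $R_{\rm punc}$ for which the sets $F^{(i)}_j\subset K^{(0)}=\Omega_{\rm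 punc}$ of a fundamental domain can be chosen so that all of them have diameter less than $\delta$ in the metric $d$. -/

import Mathlib

/-! Étale groupoids, elementary subgroupoids and almost finiteness; tilings of Euclidean space,
their hulls and the groupoid of the discrete hull. -/

namespace TilingGroupoid

/-! ### Groupoids presented by their arrows -/

/-- A groupoid presented by its set of arrows. The units are identified with the identity arrows,
so source and range are maps `G → G`; `mul a b` is defined when `src a = rng b`. -/
class ArrowGroupoid (G : Type*) where
  src : G → G
  rng : G → G
  mul : ∀ a b : G, src a = rng b → G
  inv : G → G
  src_src : ∀ a, src (src a) = src a
  rng_src : ∀ a, rng (src a) = src a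
  src_rng : ∀ a, src (rng a) = rng a
  rng_rng : ∀ a, rng (rng a) = rng a
  src_mul : ∀ a b h, src (mul a b h) = src b
  rng_mul : ∀ a b h, rng (mul a b h) = rng a
  mul_assoc : ∀ a b c (hab : src a = rng b) (hbc : src b = rng c),
    mul (mul a b hab) c ((src_mul a b hab).trans hbc) =
      mul a (mul b c hbc) (hab.trans (rng_mul b c hbc).symm)
  mul_src : ∀ a, mul a (src a) (rng_src a).symm = a
  rng_mul_self : ∀ a, mul (rng a) a (src_rng a) = a
  src_inv : ∀ a, src (inv a) = rng a
  rng_inv : ∀ a, rng (inv a) = src a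
  inv_mul : ∀ a, mul (inv a) a (src_inv a) = src a
  mul_inv : ∀ a, mul a (inv a) (rng_inv a).symm = rng a

open ArrowGroupoid

section Groupoid

variable (G : Type*) [ArrowGroupoid G]

/-- The unit space `G⁽⁰⁾ ⊆ G`. -/
def units : Set G := {u | src u = u}

variable {G}

/-- The source map `s : G → G⁽⁰⁾`. -/
def srcMap (g : G) : units G := ⟨src g, src_src g⟩

/-- The range map `r : G → G⁽⁰⁾`. -/
def rngMap (g : G) : units G := ⟨rng g, src_rng g⟩

/-- A `G`-set: range and source are injective on it. -/
def IsGSet (V : Set G) : Prop := Set.InjOn (rngMap (G := G)) V ∧ Set.InjOn (srcMap (G := G)) V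

/-- `Au = {a ∈ A | s(a) = u}`. -/
def fiber (A : Set G) (u : units G) : Set G := {a | a ∈ A ∧ srcMap a = u}

/-- `AB = {ab | a ∈ A, b ∈ B, s(a) = r(b)}`. -/
def setMul (A B : Set G) : Set G := {g | ∃ a ∈ A, ∃ b ∈ B, ∃ h : src a = rng b, g = mul a b h}

/-- `(C, ε)`-invariance of `A`: for every unit `u` the sets `CAu` and `Au` are finite, `Au` is
nonempty, and `|CAu \ Au| / |Au| < ε`. -/
def IsInvariant (C : Set G) (ε : ℝ) (A : Set G) : Prop :=
  ∀ u : units G, (fiber A u).Finite ∧ (fiber A u).Nonempty ∧ (setMul C (fiber A u)).Finite ∧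
    ((setMul C (fiber A u) \ fiber A u).ncard : ℝ) / ((fiber A u).ncard : ℝ) < ε

variable (G)

/-- Locally compact Hausdorff étale topological groupoids: multiplication and inversion are
continuous, and `r, s : G → G⁽⁰⁾` are local homeomorphisms. -/
structure IsLCHEtale [TopologicalSpace G] : Prop where
  locallyCompact : LocallyCompactSpace G
  hausdorff : T2Space G
  continuous_inv : Continuous (inv : G → G)
  continuous_mul : Continuous
    (fun p : {p : G × G // src p.1 = rng p.2} => mul p.1.1 p.1.2 p.2)
  etale_src : IsLocalHomeomorph (srcMap (G := G))
  etale_rng : IsLocalHomeomorph (rngMap (G := G))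

/-- A decomposition of a groupoid `K` (in use: a compact Hausdorff étale one) that exhibits a
fundamental domain. -/
structure FundamentalDecomposition (K : Type*) [ArrowGroupoid K] [TopologicalSpace K] where
  n : ℕ
  N : Fin n → ℕ
  N_pos : ∀ i, 0 < N i
  F : ∀ i, Fin (N i) → Set (units K)
  F_clopen : ∀ i j, IsClopen (F i j)
  F_disjoint : ∀ a b : (Σ i, Fin (N i)), a ≠ b → Disjoint (F a.1 a.2) (F b.1 b.2)
  F_cover : ⋃ i, ⋃ j, F i j = Set.univ
  V : ∀ i, Fin (N i) → Fin (N i) → Set K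
  V_spec : ∀ i j k, IsCompact (V i j k) ∧ IsOpen (V i j k) ∧ IsGSet (V i j k) ∧
    rngMap '' V i j k = F i j ∧ srcMap '' V i j k = F i k
  V_unique : ∀ i j k (V' : Set K), IsCompact V' → IsOpen V' → IsGSet V' →
    rngMap '' V' = F i j → srcMap '' V' = F i k → V' = V i j k
  V_disjoint : ∀ a b : (Σ i, Fin (N i) × Fin (N i)), a ≠ b →
    Disjoint (V a.1 a.2.1 a.2.2) (V b.1 b.2.1 b.2.2)
  V_cover : ⋃ i, ⋃ j, ⋃ k, V i j k = Set.univ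

/-- `D ⊆ K⁽⁰⁾` is a fundamental domain of `K`: it is clopen and is the union of the first sets
`F i 0` of a decomposition. -/
def IsFundamentalDomain (K : Type*) [ArrowGroupoid K] [TopologicalSpace K]
    (D : Set (units K)) : Prop :=
  IsClopen D ∧ ∃ Φ : FundamentalDecomposition K, D = ⋃ i, Φ.F i ⟨0, Φ.N_pos i⟩

/-- A subgroupoid: a set of arrows closed under inversion and (defined) products. -/
structure Subgroupoid where
  carrier : Set G
  inv_mem : ∀ a ∈ carrier, inv a ∈ carrier
  mul_mem : ∀ a ∈ carrier, ∀ b ∈ carrier, ∀ h : src a = rng b, mul a b h ∈ carrier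

variable {G}

theorem Subgroupoid.src_mem (K : Subgroupoid G) {a : G} (ha : a ∈ K.carrier) :
    src a ∈ K.carrier := by
  rw [← inv_mul a]; exact K.mul_mem _ (K.inv_mem a ha) _ ha _

theorem Subgroupoid.rng_mem (K : Subgroupoid G) {a : G} (ha : a ∈ K.carrier) :
    rng a ∈ K.carrier := by
  rw [← mul_inv a]; exact K.mul_mem _ ha _ (K.inv_mem a ha) _

/-- A subgroupoid is a groupoid (with the relative topology). -/
instance (K : Subgroupoid G) : ArrowGroupoid K.carrier where
  src a := ⟨src a.1, K.src_mem a.2⟩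
  rng a := ⟨rng a.1, K.rng_mem a.2⟩
  mul a b h := ⟨mul a.1 b.1 (congrArg Subtype.val h),
    K.mul_mem _ a.2 _ b.2 (congrArg Subtype.val h)⟩
  inv a := ⟨inv a.1, K.inv_mem _ a.2⟩
  src_src a := Subtype.ext (src_src a.1)
  rng_src a := Subtype.ext (rng_src a.1)
  src_rng a := Subtype.ext (src_rng a.1)
  rng_rng a := Subtype.ext (rng_rng a.1)
  src_mul _ _ _ := Subtype.ext (src_mul _ _ _)
  rng_mul _ _ _ := Subtype.ext (rng_mul _ _ _)
  mul_assoc _ _ _ _ _ := Subtype.ext (mul_assoc _ _ _ _ _)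
  mul_src a := Subtype.ext (mul_src a.1)
  rng_mul_self a := Subtype.ext (rng_mul_self a.1)
  src_inv a := Subtype.ext (src_inv a.1)
  rng_inv a := Subtype.ext (rng_inv a.1)
  inv_mul a := Subtype.ext (inv_mul a.1)
  mul_inv a := Subtype.ext (mul_inv a.1)

/-- An elementary subgroupoid: a compact (Hausdorff étale) subgroupoid that contains `G⁽⁰⁾` and
admits a fundamental domain. -/
structure Subgroupoid.IsElementary [TopologicalSpace G] (K : Subgroupoid G) : Prop where
  units_subset : units G ⊆ K.carrier
  compact : IsCompact K.carrier
  etale : IsLCHEtale K.carrier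
  fundamental : ∃ D, IsFundamentalDomain K.carrier D

variable (G)

/-- Almost finiteness of a locally compact Hausdorff étale groupoid. -/
structure IsAlmostFinite [TopologicalSpace G] : Prop where
  etale : IsLCHEtale G
  covered : ∀ g : G, ∃ V : Set G, IsCompact V ∧ IsOpen V ∧ IsGSet V ∧ g ∈ V
  elementary : ∀ C : Set G, IsCompact C → ∀ ε : ℝ, 0 < ε →
    ∃ K : Subgroupoid G, K.IsElementary ∧ IsInvariant C ε K.carrier

end Groupoid

/-! ### Tilings -/

/-- A finite family of prototiles in `ℝ^d`, labelled by `ι`: subsets homeomorphic to the closed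
unit ball, each with a distinguished interior point, its puncture. -/
structure PrototileSet (d : ℕ) (ι : Type*) [Finite ι] where
  carrier : ι → Set (EuclideanSpace ℝ (Fin d))
  homeo : ∀ i, Nonempty (carrier i ≃ₜ Metric.closedBall (0 : EuclideanSpace ℝ (Fin d)) 1)
  puncture : ι → EuclideanSpace ℝ (Fin d)
  puncture_mem : ∀ i, puncture i ∈ interior (carrier i)

/-- A tile, i.e. a translated labelled prototile: `(i, x)` stands for the labelled set
`p_i + x`. -/
abbrev Tile (d : ℕ) (ι : Type*) := ι × EuclideanSpace ℝ (Fin d)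

section Tiling

variable {d : ℕ} {ι : Type*} [Finite ι]

/-- The set `p_i + x` underlying the tile `(i, x)`. -/
def PrototileSet.support (P : PrototileSet d ι) (t : Tile d ι) :
    Set (EuclideanSpace ℝ (Fin d)) := (fun y => y + t.2) '' P.carrier t.1

/-- The puncture of a tile, `x(p_i + y) = x(p_i) + y`. -/
def PrototileSet.punct (P : PrototileSet d ι) (t : Tile d ι) : EuclideanSpace ℝ (Fin d) :=
  P.puncture t.1 + t.2

/-- The translate `Q + x` of a set of tiles. -/
def translateTiles (Q : Set (Tile d ι)) (x : EuclideanSpace ℝ (Fin d)) : Set (Tile d ι) :=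
  (fun t => (t.1, t.2 + x)) '' Q

/-- A tiling with prototile set `P`. -/
@[ext]
structure Tiling (P : PrototileSet d ι) where
  tiles : Set (Tile d ι)
  cover : ⋃ t ∈ tiles, P.support t = Set.univ
  disjoint : ∀ t ∈ tiles, ∀ t' ∈ tiles, t ≠ t' →
    Disjoint (interior (P.support t)) (interior (P.support t'))

variable {P : PrototileSet d ι}

theorem support_add (P : PrototileSet d ι) (t : Tile d ι) (x : EuclideanSpace ℝ (Fin d)) :
    P.support (t.1, t.2 + x) = (Homeomorph.addRight x) '' P.support t := by
  ext y; simp [PrototileSet.support, add_assoc]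

/-- The translate `T + x`. -/
def Tiling.translate (T : Tiling P) (x : EuclideanSpace ℝ (Fin d)) : Tiling P where
  tiles := translateTiles T.tiles x
  cover := by
    rw [Set.eq_univ_iff_forall]
    intro y
    have h : y - x ∈ ⋃ t ∈ T.tiles, P.support t := by rw [T.cover]; trivial
    obtain ⟨t, ht, hy⟩ := Set.mem_iUnion₂.1 h
    refine Set.mem_iUnion₂.2 ⟨(t.1, t.2 + x), ⟨t, ht, rfl⟩, ?_⟩
    rw [support_add]
    exact ⟨y - x, hy, by simp⟩
  disjoint := by
    rintro _ ⟨t, ht, rfl⟩ _ ⟨t', ht', rfl⟩ hne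
    simp only [support_add, ← Homeomorph.image_interior]
    refine (Set.disjoint_image_iff (Homeomorph.injective _)).2 (T.disjoint t ht t' ht' ?_)
    rintro rfl; exact hne rfl

/-- `T ⊓ B_r(x)`: the tiles of `T` that meet the ball of radius `r` about `x`. -/
def Tiling.ballPatch (T : Tiling P) (x : EuclideanSpace ℝ (Fin d)) (r : ℝ) : Set (Tile d ι) :=
  {t | t ∈ T.tiles ∧ (P.support t ∩ Metric.ball x r).Nonempty}

/-- A patch of `T`: a finite connected set of tiles of `T`. -/
def Tiling.IsPatch (T : Tiling P) (Q : Set (Tile d ι)) : Prop :=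
  Q ⊆ T.tiles ∧ Q.Finite ∧ IsConnected (⋃ t ∈ Q, P.support t)

/-- `T₁` and `T₂` are `ε`-close. -/
def EpsClose (T₁ T₂ : Tiling P) (ε : ℝ) : Prop :=
  ∃ x₁ x₂ : EuclideanSpace ℝ (Fin d), ‖x₁‖ ≤ ε ∧ ‖x₂‖ ≤ ε ∧
    (T₁.translate x₁).ballPatch 0 ε⁻¹ = (T₂.translate x₂).ballPatch 0 ε⁻¹

/-- The tiling metric: the infimum of those `ε ∈ (0, 1)` for which `T₁` and `T₂` are `ε`-close,
and `1` if there are none. -/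
noncomputable def tilingDist (T₁ T₂ : Tiling P) : ℝ :=
  sInf (insert 1 {ε | 0 < ε ∧ ε < 1 ∧ EpsClose T₁ T₂ ε})

theorem Tiling.translate_zero (T : Tiling P) : T.translate 0 = T := by
  ext1; simp [Tiling.translate, translateTiles]

theorem Tiling.translate_translate (T : Tiling P) (x y : EuclideanSpace ℝ (Fin d)) :
    (T.translate x).translate y = T.translate (x + y) := by
  ext1; simp [Tiling.translate, translateTiles, Set.image_image, add_assoc]

theorem mem_ballPatch_translate {T : Tiling P} {x y : EuclideanSpace ℝ (Fin d)} {r : ℝ}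
    {t : Tile d ι} : (t.1, t.2 + x) ∈ (T.translate x).ballPatch (y + x) r ↔
      t ∈ T.ballPatch y r := by
  have h1 : (t.1, t.2 + x) ∈ (T.translate x).tiles ↔ t ∈ T.tiles := by
    constructor
    · rintro ⟨t', ht', he⟩
      rw [Prod.mk.injEq] at he
      have : t' = t := Prod.ext he.1 (by simpa using he.2)
      exact this ▸ ht'
    · exact fun h => ⟨t, h, rfl⟩
  have h2 : (P.support (t.1, t.2 + x) ∩ Metric.ball (y + x) r).Nonempty ↔
      (P.support t ∩ Metric.ball y r).Nonempty := by
    rw [support_add]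
    constructor
    · rintro ⟨_, ⟨z, hz, rfl⟩, hb⟩
      exact ⟨z, hz, by simpa using hb⟩
    · rintro ⟨z, hz, hb⟩
      exact ⟨z + x, ⟨z, hz, rfl⟩, by simpa using hb⟩
  exact and_congr h1 h2

theorem ballPatch_mono {T : Tiling P} {x y : EuclideanSpace ℝ (Fin d)} {r r' : ℝ}
    (h : Metric.ball x r ⊆ Metric.ball y r') : T.ballPatch x r ⊆ T.ballPatch y r' :=
  fun _ ht => ⟨ht.1, ht.2.mono (Set.inter_subset_inter_right _ h)⟩

/-- Tilings that agree on a ball have translates that agree on each smaller ball. -/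
theorem ballPatch_translate_eq {T₁ T₂ : Tiling P} {R s : ℝ} {y : EuclideanSpace ℝ (Fin d)}
    (h : T₁.ballPatch 0 R = T₂.ballPatch 0 R) (hs : s + ‖y‖ ≤ R) :
    (T₁.translate y).ballPatch 0 s = (T₂.translate y).ballPatch 0 s := by
  have key : ∀ T T' : Tiling P, T.ballPatch 0 R = T'.ballPatch 0 R →
      (T.translate y).ballPatch 0 s ⊆ (T'.translate y).ballPatch 0 s := by
    intro T T' hTT t ht
    obtain ⟨t', ht', rfl⟩ := ht.1
    have hb : Metric.ball (-y) s ⊆ Metric.ball (0 : EuclideanSpace ℝ (Fin d)) R :=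
      Metric.ball_subset_ball' (by simpa using hs)
    have e : (0 : EuclideanSpace ℝ (Fin d)) = -y + y := by simp
    rw [e] at ht ⊢
    rw [mem_ballPatch_translate] at ht ⊢
    have hT' : t' ∈ T'.ballPatch 0 R := hTT ▸ ballPatch_mono hb ht
    exact ⟨hT'.1, ht.2⟩
  exact Set.Subset.antisymm (key _ _ h) (key _ _ h.symm)

theorem EpsClose.mono {T₁ T₂ : Tiling P} {ε ε' : ℝ} (h0 : 0 < ε) (h : EpsClose T₁ T₂ ε)
    (hle : ε ≤ ε') : EpsClose T₁ T₂ ε' := by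
  obtain ⟨x₁, x₂, h1, h2, he⟩ := h
  refine ⟨x₁, x₂, h1.trans hle, h2.trans hle, ?_⟩
  have := ballPatch_translate_eq (y := 0) (s := ε'⁻¹) he
    (by simpa using inv_anti₀ h0 hle)
  simpa [Tiling.translate_zero] using this

theorem tilingDist_bddBelow (T₁ T₂ : Tiling P) :
    BddBelow (insert 1 {ε : ℝ | 0 < ε ∧ ε < 1 ∧ EpsClose T₁ T₂ ε}) := by
  refine ⟨0, ?_⟩
  rintro a (rfl | ha)
  · exact zero_le_one
  · exact ha.1.le

theorem tilingDist_le_one (T₁ T₂ : Tiling P) : tilingDist T₁ T₂ ≤ 1 :=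
  csInf_le (tilingDist_bddBelow _ _) (Set.mem_insert _ _)

theorem tilingDist_nonneg (T₁ T₂ : Tiling P) : 0 ≤ tilingDist T₁ T₂ := by
  refine le_csInf (Set.insert_nonempty _ _) ?_
  rintro a (rfl | ha)
  · exact zero_le_one
  · exact ha.1.le

theorem epsClose_of_dist_lt {T₁ T₂ : Tiling P} {a : ℝ} (h : tilingDist T₁ T₂ < a) (ha : a ≤ 1) :
    EpsClose T₁ T₂ a := by
  obtain ⟨ε, hε, hlt⟩ := exists_lt_of_csInf_lt (Set.insert_nonempty _ _) h
  rcases hε with rfl | hε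
  · exact absurd ha (not_le.2 hlt)
  · exact hε.2.2.mono hε.1 hlt.le

theorem tilingDist_le_of_close {T₁ T₂ : Tiling P} {a : ℝ} (h0 : 0 < a)
    (h : EpsClose T₁ T₂ a) : tilingDist T₁ T₂ ≤ a := by
  rcases lt_or_ge a 1 with h1 | h1
  · exact csInf_le (tilingDist_bddBelow _ _) (Or.inr ⟨h0, h1, h⟩)
  · exact (tilingDist_le_one _ _).trans h1

theorem EpsClose.symm {T₁ T₂ : Tiling P} {ε : ℝ} (h : EpsClose T₁ T₂ ε) : EpsClose T₂ T₁ ε := by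
  obtain ⟨x₁, x₂, h1, h2, he⟩ := h
  exact ⟨x₂, x₁, h2, h1, he.symm⟩

theorem tilingDist_comm (T₁ T₂ : Tiling P) : tilingDist T₁ T₂ = tilingDist T₂ T₁ := by
  unfold tilingDist
  congr 2
  ext ε
  exact ⟨fun h => ⟨h.1, h.2.1, h.2.2.symm⟩, fun h => ⟨h.1, h.2.1, h.2.2.symm⟩⟩

theorem tilingDist_self (T : Tiling P) : tilingDist T T = 0 := by
  refine le_antisymm (le_of_forall_pos_le_add fun ε hε => ?_) (tilingDist_nonneg _ _)
  rw [zero_add]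
  exact tilingDist_le_of_close hε ⟨0, 0, by simpa using hε.le, by simpa using hε.le, rfl⟩

theorem EpsClose.trans {T₁ T₂ T₃ : Tiling P} {a b : ℝ} (ha : 0 < a) (hb : 0 < b)
    (hab : a + b ≤ 1) (h12 : EpsClose T₁ T₂ a) (h23 : EpsClose T₂ T₃ b) :
    EpsClose T₁ T₃ (a + b) := by
  obtain ⟨x₁, x₂, hx1, hx2, he⟩ := h12
  obtain ⟨y₂, y₃, hy2, hy3, hf⟩ := h23
  have key : ∀ u v : ℝ, 0 < u → 0 < v → u + v ≤ 1 → (u + v)⁻¹ + v ≤ u⁻¹ := by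
    intro u v hu hv huv
    have e : u⁻¹ - (u + v)⁻¹ = v / (u * (u + v)) := by field_simp; ring
    have : v ≤ v / (u * (u + v)) := by
      rw [le_div_iff₀ (by positivity)]
      have : u * (u + v) ≤ 1 := by nlinarith
      nlinarith
    linarith
  refine ⟨x₁ + y₂, y₃ + x₂, (norm_add_le _ _).trans (by linarith),
    (norm_add_le _ _).trans (by linarith), ?_⟩
  have h1 := ballPatch_translate_eq (y := y₂) (s := (a + b)⁻¹) he
    (le_trans (by linarith) (key a b ha hb hab))
  have h2 := ballPatch_translate_eq (y := x₂) (s := (a + b)⁻¹) hf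
    (le_trans (b := (b + a)⁻¹ + a) (by rw [add_comm b a]; linarith)
      (key b a hb ha (by linarith)))
  rw [Tiling.translate_translate, Tiling.translate_translate] at h1 h2
  rw [h1, add_comm x₂ y₂, h2]

theorem tilingDist_triangle (T₁ T₂ T₃ : Tiling P) :
    tilingDist T₁ T₃ ≤ tilingDist T₁ T₂ + tilingDist T₂ T₃ := by
  refine le_of_forall_pos_le_add fun ε hε => ?_
  have h12 := tilingDist_nonneg T₁ T₂
  have h23 := tilingDist_nonneg T₂ T₃
  set a := tilingDist T₁ T₂ + ε / 2 with ha
  set b := tilingDist T₂ T₃ + ε / 2 with hb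
  have e : tilingDist T₁ T₂ + tilingDist T₂ T₃ + ε = a + b := by rw [ha, hb]; ring
  rw [e]
  rcases le_or_gt (a + b) 1 with h | h
  · refine tilingDist_le_of_close (by linarith) (EpsClose.trans (T₂ := T₂) (by linarith)
      (by linarith) h ?_ ?_)
    · exact epsClose_of_dist_lt (by linarith) (by linarith)
    · exact epsClose_of_dist_lt (by linarith) (by linarith)
  · exact (tilingDist_le_one _ _).trans h.le

theorem subset_of_tilingDist_eq_zero {T₁ T₂ : Tiling P} (h : tilingDist T₁ T₂ = 0) :
    T₁.tiles ⊆ T₂.tiles := by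
  rintro ⟨i, a⟩ ht
  obtain ⟨ρ, hρ, hball⟩ := Metric.isOpen_iff.1 isOpen_interior _ (P.puncture_mem i)
  set q := P.puncture i + a with hq
  -- tiles of the second tiling near the given one
  have near : ∀ ε : ℝ, 0 < ε → ∃ w : EuclideanSpace ℝ (Fin d), ‖w‖ ≤ ε ∧ (i, a + w) ∈ T₂.tiles := by
    intro ε hε
    set η := min (ε / 2) (‖q‖ + 2)⁻¹ with hη
    have hpos : 0 < ‖q‖ + 2 := by positivity
    have hη0 : 0 < η := lt_min (by linarith) (inv_pos.2 hpos)
    have hη2 : η ≤ ε / 2 := min_le_left _ _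
    have hη3 : η ≤ (‖q‖ + 2)⁻¹ := min_le_right _ _
    have hη1 : η ≤ 1 := hη3.trans (inv_le_one_of_one_le₀ (by linarith [norm_nonneg q]))
    obtain ⟨x₁, x₂, h1, h2, he⟩ := epsClose_of_dist_lt (h.symm ▸ hη0) hη1
    have hmem : ((i, a + x₁) : Tile d ι) ∈ (T₁.translate x₁).ballPatch 0 η⁻¹ := by
      refine ⟨⟨(i, a), ht, rfl⟩, q + x₁, ⟨P.puncture i, interior_subset (P.puncture_mem i), ?_⟩, ?_⟩
      · simp [hq, add_assoc]
      · rw [mem_ball_zero_iff]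
        have : ‖q‖ + 2 ≤ η⁻¹ := by
          have := inv_anti₀ hη0 hη3
          rwa [inv_inv] at this
        have := norm_add_le q x₁
        linarith
    rw [he] at hmem
    obtain ⟨⟨j, c⟩, hjc, hjc'⟩ := hmem.1
    simp only [Prod.mk.injEq] at hjc'
    obtain ⟨rfl, hc⟩ := hjc'
    refine ⟨x₁ - x₂, (norm_sub_le _ _).trans (by linarith), ?_⟩
    have : a + (x₁ - x₂) = c := by
      rw [← add_sub_assoc, ← hc, add_sub_cancel_right]
    rw [this]; exact hjc
  obtain ⟨w, hw, hwT⟩ := near (ρ / 4) (by linarith)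
  have hw0 : w = 0 := by
    rw [← norm_le_zero_iff]
    refine le_of_forall_pos_le_add fun ε hε => ?_
    rw [zero_add]
    obtain ⟨w', hw', hwT'⟩ := near (min ε (ρ / 4)) (lt_min hε (by linarith))
    have hint : ∀ v : EuclideanSpace ℝ (Fin d), ‖w - v‖ < ρ →
        q + w ∈ interior (P.support (i, a + v)) := by
      intro v hv
      have hs : P.support (i, a + v) = (Homeomorph.addRight (a + v)) '' P.carrier i := rfl
      rw [hs, ← Homeomorph.image_interior]
      refine ⟨P.puncture i + (w - v), hball ?_, ?_⟩
      · simpa using hv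
      · simp only [Homeomorph.coe_addRight, hq]; abel
    have hww : w = w' := by
      by_contra hne
      have hd := T₂.disjoint _ hwT _ hwT' (by
        intro e
        rw [Prod.mk.injEq] at e
        exact hne (add_left_cancel e.2))
      refine Set.disjoint_left.1 hd (hint w (by simpa using hρ)) (hint w' ?_)
      have := norm_sub_le w w'
      have := hw'.trans (min_le_right _ _)
      linarith
    rw [hww]
    exact hw'.trans (min_le_left _ _)
  simpa [hw0] using hwT

noncomputable instance : MetricSpace (Tiling P) where
  dist := tilingDist
  dist_self := tilingDist_self
  dist_comm := tilingDist_comm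
  dist_triangle := tilingDist_triangle
  eq_of_dist_eq_zero {T₁ T₂} h := Tiling.ext (Set.Subset.antisymm
    (subset_of_tilingDist_eq_zero h)
    (subset_of_tilingDist_eq_zero ((tilingDist_comm T₂ T₁).trans h)))

/-- The continuous hull `Ω_T`. The completion of the orbit `T + ℝ^d` is realised as its closure
in the metric space of all tilings with the same prototiles. -/
def Tiling.hull (T : Tiling P) : Set (Tiling P) := closure (Set.range fun x => T.translate x)

/-- Finite local complexity: for each `R > 0` there are, up to translation, only finitely many
`T ⊓ B_R(x)`. -/
def Tiling.HasFLC (T : Tiling P) : Prop :=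
  ∀ R : ℝ, 0 < R → ∃ S : Set (Set (Tile d ι)), S.Finite ∧
    ∀ x, ∃ Q ∈ S, ∃ y, T.ballPatch x R = translateTiles Q y

def Tiling.IsNonperiodic (T : Tiling P) : Prop := ∀ x, T.translate x = T → x = 0

def Tiling.IsAperiodic (T : Tiling P) : Prop := ∀ T' ∈ T.hull, T'.IsNonperiodic

def Tiling.IsRepetitive (T : Tiling P) : Prop :=
  ∀ Q, T.IsPatch Q → ∃ R : ℝ, 0 < R ∧ ∀ x, ∃ y, translateTiles Q y ⊆ T.ballPatch x R

/-- The discrete hull `Ω_punc`, with the tiling metric: the tilings in the hull for which the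
origin is a puncture of a tile. -/
abbrev DiscreteHull (T : Tiling P) :=
  {T' : Tiling P // T' ∈ T.hull ∧ ∃ t ∈ T'.tiles, P.punct t = 0}

/-- The tiling groupoid `R_punc = {(T', T' - x(t)) | T' ∈ Ω_punc, t ∈ T'}`. -/
@[ext]
structure RPunc (T : Tiling P) where
  fst : DiscreteHull T
  snd : DiscreteHull T
  rel : ∃ t ∈ fst.1.tiles, snd.1 = fst.1.translate (-P.punct t)

variable {T : Tiling P}

theorem RPunc.rel_refl (S : DiscreteHull T) :
    ∃ t ∈ S.1.tiles, S.1 = S.1.translate (-P.punct t) := by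
  obtain ⟨t, ht, h0⟩ := S.2.2
  exact ⟨t, ht, by rw [h0, neg_zero, Tiling.translate_zero]⟩

theorem RPunc.rel_symm (g : RPunc T) :
    ∃ t ∈ g.snd.1.tiles, g.fst.1 = g.snd.1.translate (-P.punct t) := by
  obtain ⟨t, ht, h⟩ := g.rel
  obtain ⟨t₀, ht₀, h0⟩ := g.fst.2.2
  refine ⟨(t₀.1, t₀.2 + -P.punct t), by rw [h]; exact ⟨t₀, ht₀, rfl⟩, ?_⟩
  have e : P.punct (t₀.1, t₀.2 + -P.punct t) = -P.punct t := by
    have : P.punct (t₀.1, t₀.2 + -P.punct t) = P.punct t₀ + -P.punct t := by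
      simp only [PrototileSet.punct, add_assoc]
    rw [this, h0, zero_add]
  rw [e, h, Tiling.translate_translate, neg_neg, neg_add_cancel, Tiling.translate_zero]

theorem RPunc.rel_trans (g h : RPunc T) (e : g.snd = h.fst) :
    ∃ t ∈ g.fst.1.tiles, h.snd.1 = g.fst.1.translate (-P.punct t) := by
  obtain ⟨t, ht, hg⟩ := g.rel
  obtain ⟨t', ht', hh⟩ := h.rel
  rw [← e, hg] at ht' hh
  obtain ⟨t₂, ht₂, rfl⟩ := ht'
  refine ⟨t₂, ht₂, ?_⟩
  rw [hh, Tiling.translate_translate]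
  congr 1
  simp only [PrototileSet.punct]
  abel

/-- `(T, T')(T', T'') = (T, T'')`, `(T, T')⁻¹ = (T', T)`, `r(T, T') = T`, `s(T, T') = T'`, where
a unit `T` is the arrow `(T, T)`. -/
instance : ArrowGroupoid (RPunc T) where
  src g := ⟨g.snd, g.snd, RPunc.rel_refl _⟩
  rng g := ⟨g.fst, g.fst, RPunc.rel_refl _⟩
  mul g h e := ⟨g.fst, h.snd, RPunc.rel_trans g h (congrArg RPunc.fst e)⟩
  inv g := ⟨g.snd, g.fst, RPunc.rel_symm g⟩
  src_src _ := rfl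
  rng_src _ := rfl
  src_rng _ := rfl
  rng_rng _ := rfl
  src_mul _ _ _ := rfl
  rng_mul _ _ _ := rfl
  mul_assoc _ _ _ _ _ := rfl
  mul_src _ := rfl
  rng_mul_self _ := rfl
  src_inv _ := rfl
  rng_inv _ := rfl
  inv_mul _ := rfl
  mul_inv _ := rfl

/-- The vector `x(t)` with `g = (T', T' - x(t))`; it is unique if `T` is aperiodic. -/
noncomputable def RPunc.vec (g : RPunc T) : EuclideanSpace ℝ (Fin d) :=
  P.punct g.rel.choose

theorem RPunc.snd_eq (g : RPunc T) : g.snd.1 = g.fst.1.translate (-g.vec) :=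
  g.rel.choose_spec.2

/-- The metric `d(T₁, T₂) + ‖x(t₁) - x(t₂)‖` on arrows `(T₁, T₁ - x(t₁))`, `(T₂, T₂ - x(t₂))`. -/
noncomputable instance : MetricSpace (RPunc T) where
  dist g h := dist g.fst h.fst + ‖g.vec - h.vec‖
  dist_self g := by simp
  dist_comm g h := by rw [dist_comm, norm_sub_rev]
  dist_triangle g h k := by
    have h1 := dist_triangle g.fst h.fst k.fst
    have h2 := norm_sub_le_norm_sub_add_norm_sub g.vec h.vec k.vec
    linarith
  eq_of_dist_eq_zero {g h} e := by
    have e1 : dist g.fst h.fst = 0 := by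
      linarith [dist_nonneg (x := g.fst) (y := h.fst), norm_nonneg (g.vec - h.vec)]
    have e2 : ‖g.vec - h.vec‖ = 0 := by
      linarith [dist_nonneg (x := g.fst) (y := h.fst), norm_nonneg (g.vec - h.vec)]
    have e3 := eq_of_dist_eq_zero e1
    have e4 : g.vec = h.vec := sub_eq_zero.1 (norm_eq_zero.1 e2)
    refine RPunc.ext e3 (Subtype.ext ?_)
    rw [g.snd_eq, h.snd_eq, e3, e4]

/-- The identification of the unit space of a subgroupoid of `R_punc` with a subset of `Ω_punc`. -/
def unitTiling (K : Subgroupoid (RPunc T)) (u : units K.carrier) : DiscreteHull T := u.1.1.fst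

end Tiling

end TilingGroupoid

open TilingGroupoid

/-! Aperiodicity makes the displacement `vec` of an arrow well defined and additive. Since punctures
in a tiling are uniformly separated, two close tilings of the discrete hull agree exactly on a large
ball. Hence `vec` is locally constant, and FLC makes the discrete hull compact. The sets on which
`vec` is constant are compact open bisections, and the étale structure follows (`RPunc.isLCHEtale`).

For an elementary subgroupoid, fix a large patch of `T`. Its occurrences in a tiling of the hull are
relatively dense by repetitivity and as sparse as desired by aperiodicity: a difference of two close
occurrences is one of finitely many vectors, and a large patch excludes each nonzero one
(`Tiling.exists_pairwiseSep_occurrences`). Each puncture is assigned to a nearest occurrence, ties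
being broken by a rule that depends only on the view from the puncture (`exists_centreMap`). This
rule is locally determined and commutes with translation, so the arrows between punctures of one
cell form a compact open subgroupoid.

It is decomposed by label, a patch of large radius about the centre, and by the position of the
origin relative to the centre. A large enough label determines which positions belong to the cell,
which gives the bisections `V i j k`; enlarging it further makes the pieces small
(`CentreMap.exists_decomposition_ediam_lt`).

For invariance, the fibre over a unit is the cell of the origin, and a compact `C` moves punctures
by at most some `ρ`. Cells follow Voronoi cells of a sparse set. Comparing volumes of the Voronoi
cell dilated by `1 ± η` shows that few punctures lie outside a cell but within `ρ` of it
(`exists_sep_boundary_lt`). -/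

namespace TilingGroupoid

open Metric Set

/-! ### Separated sets -/

/-- Distinct points of `A` have distance at least `s`. -/
def PairwiseSep {E : Type*} [NormedAddCommGroup E] (s : ℝ) (A : Set E) : Prop :=
  ∀ x ∈ A, ∀ y ∈ A, ‖x - y‖ < s → x = y

theorem PairwiseSep.mono {E : Type*} [NormedAddCommGroup E] {s : ℝ} {A B : Set E}
    (h : PairwiseSep s B) (hAB : A ⊆ B) : PairwiseSep s A :=
  fun x hx y hy => h x (hAB hx) y (hAB hy)

theorem PairwiseSep.finite_of_isBounded {E : Type*} [NormedAddCommGroup E] [ProperSpace E] {s : ℝ}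
    (hs : 0 < s) {A : Set E} (hA : PairwiseSep s A) (hb : Bornology.IsBounded A) : A.Finite := by
  obtain ⟨t, ht, hcov⟩ := Metric.totallyBounded_iff.1
    (hb.isCompact_closure.totallyBounded.subset subset_closure) (s / 2) (by linarith)
  refine (ht.biUnion (t := fun y => A ∩ ball y (s / 2)) fun y _ => ?_).subset fun x hx => ?_
  · refine Set.Subsingleton.finite fun a ha b hb => hA a ha.1 b hb.1 ?_
    have h1 := mem_ball.1 ha.2
    have h2 := mem_ball'.1 hb.2
    rw [← dist_eq_norm]
    linarith [dist_triangle a y b]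
  · obtain ⟨y, hy, hxy⟩ := mem_iUnion₂.1 (hcov hx)
    exact mem_iUnion₂.2 ⟨y, hy, hx, hxy⟩

theorem translateTiles_translateTiles {d : ℕ} {ι : Type*} (Q : Set (Tile d ι))
    (x y : EuclideanSpace ℝ (Fin d)) :
    translateTiles (translateTiles Q x) y = translateTiles Q (x + y) := by
  simp [translateTiles, Set.image_image, add_assoc]

theorem translateTiles_zero {d : ℕ} {ι : Type*} (Q : Set (Tile d ι)) : translateTiles Q 0 = Q := by
  simp [translateTiles]

theorem translateTiles_mono {d : ℕ} {ι : Type*} {Q Q' : Set (Tile d ι)} (h : Q ⊆ Q')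
    (x : EuclideanSpace ℝ (Fin d)) :
    translateTiles Q x ⊆ translateTiles Q' x := Set.image_mono h

section Tiling

variable {d : ℕ} {ι : Type*} [Finite ι] {P : PrototileSet d ι}

/-! ### Geometry of tiles -/

theorem PrototileSet.isCompact_carrier (P : PrototileSet d ι) (i : ι) :
    IsCompact (P.carrier i) := by
  obtain ⟨h⟩ := P.homeo i
  have := isCompact_iff_compactSpace.1
    (isCompact_closedBall (0 : EuclideanSpace ℝ (Fin d)) 1)
  exact isCompact_iff_compactSpace.2 h.symm.compactSpace

theorem PrototileSet.isPreconnected_carrier (P : PrototileSet d ι) (i : ι) :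
    IsPreconnected (P.carrier i) := by
  obtain ⟨h⟩ := P.homeo i
  have := isPreconnected_iff_preconnectedSpace.1
    (convex_closedBall (0 : EuclideanSpace ℝ (Fin d)) 1).isPreconnected
  have h2 : PreconnectedSpace (P.carrier i) := h.symm.surjective.denseRange.preconnectedSpace
    h.symm.continuous
  exact isPreconnected_iff_preconnectedSpace.2 h2

theorem PrototileSet.exists_inradius (P : PrototileSet d ι) :
    ∃ s : ℝ, 0 < s ∧ ∀ i, ball (P.puncture i) s ⊆ interior (P.carrier i) := by
  have h : ∀ i, ∃ s : ℝ, 0 < s ∧ ball (P.puncture i) s ⊆ interior (P.carrier i) := fun i =>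
    Metric.isOpen_iff.1 isOpen_interior _ (P.puncture_mem i)
  choose s hs hb using h
  obtain ⟨r, hr, hrs⟩ : ∃ r : ℝ, 0 < r ∧ ∀ i, r ≤ s i := by
    rcases isEmpty_or_nonempty ι with _ | _
    · exact ⟨1, one_pos, fun i => isEmptyElim i⟩
    · obtain ⟨i, hi⟩ := Finite.exists_min s
      exact ⟨s i, hs i, hi⟩
  exact ⟨r, hr, fun i => (ball_subset_ball (hrs i)).trans (hb i)⟩

theorem PrototileSet.exists_outradius (P : PrototileSet d ι) :
    ∃ M : ℝ, 0 < M ∧ ∀ i, P.carrier i ⊆ closedBall (P.puncture i) M := by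
  have h : ∀ i, ∃ M : ℝ, P.carrier i ⊆ closedBall (P.puncture i) M := fun i =>
    (P.isCompact_carrier i).isBounded.subset_closedBall _
  choose M hM using h
  obtain ⟨r, hr⟩ := (Set.finite_range M).bddAbove
  exact ⟨max r 1, by positivity, fun i => (hM i).trans
    (closedBall_subset_closedBall ((hr ⟨i, rfl⟩).trans (le_max_left _ _)))⟩

/-- A radius `s` such that the ball of radius `s` about the puncture of a tile lies in the
interior of the tile. -/
noncomputable def PrototileSet.inr (P : PrototileSet d ι) : ℝ := P.exists_inradius.choose

/-- A radius `M` such that each tile lies in the ball of radius `M` about its puncture. -/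
noncomputable def PrototileSet.outr (P : PrototileSet d ι) : ℝ := P.exists_outradius.choose

theorem PrototileSet.inr_pos (P : PrototileSet d ι) : 0 < P.inr := P.exists_inradius.choose_spec.1

theorem PrototileSet.outr_pos (P : PrototileSet d ι) : 0 < P.outr :=
  P.exists_outradius.choose_spec.1

theorem support_eq_image (P : PrototileSet d ι) (t : Tile d ι) :
    P.support t = (Homeomorph.addRight t.2) '' P.carrier t.1 := rfl

theorem isCompact_support (P : PrototileSet d ι) (t : Tile d ι) : IsCompact (P.support t) :=
  (P.isCompact_carrier t.1).image (Homeomorph.addRight t.2).continuous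

theorem isPreconnected_support (P : PrototileSet d ι) (t : Tile d ι) :
    IsPreconnected (P.support t) :=
  (P.isPreconnected_carrier t.1).image _ (Homeomorph.addRight t.2).continuous.continuousOn

theorem ball_puncture_subset (P : PrototileSet d ι) (i : ι) :
    ball (P.puncture i) P.inr ⊆ interior (P.carrier i) := P.exists_inradius.choose_spec.2 i

theorem carrier_subset_closedBall (P : PrototileSet d ι) (i : ι) :
    P.carrier i ⊆ closedBall (P.puncture i) P.outr := P.exists_outradius.choose_spec.2 i

theorem ball_punct_subset (P : PrototileSet d ι) (t : Tile d ι) :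
    ball (P.punct t) P.inr ⊆ interior (P.support t) := by
  intro y hy
  rw [support_eq_image, ← Homeomorph.image_interior]
  refine ⟨y - t.2, ball_puncture_subset P t.1 ?_, by simp⟩
  rw [mem_ball, dist_eq_norm] at hy ⊢
  convert hy using 2
  simp only [PrototileSet.punct]; abel

theorem punct_mem_interior (P : PrototileSet d ι) (t : Tile d ι) :
    P.punct t ∈ interior (P.support t) :=
  ball_punct_subset P t (mem_ball_self P.inr_pos)

theorem punct_mem_support (P : PrototileSet d ι) (t : Tile d ι) : P.punct t ∈ P.support t :=
  interior_subset (punct_mem_interior P t)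

theorem norm_sub_punct_le {t : Tile d ι} {y : EuclideanSpace ℝ (Fin d)}
    (hy : y ∈ P.support t) : ‖y - P.punct t‖ ≤ P.outr := by
  obtain ⟨z, hz, rfl⟩ := hy
  have := carrier_subset_closedBall P t.1 hz
  rw [mem_closedBall, dist_eq_norm] at this
  change ‖z + t.2 - (P.puncture t.1 + t.2)‖ ≤ _
  rwa [add_sub_add_right_eq_sub]

theorem punct_translate (P : PrototileSet d ι) (t : Tile d ι) (x : EuclideanSpace ℝ (Fin d)) :
    P.punct (t.1, t.2 + x) = P.punct t + x := by
  simp only [PrototileSet.punct, add_assoc]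

/-! ### Punctures -/

/-- The set of punctures of the tiles of `S`. -/
def Tiling.puncts (S : Tiling P) : Set (EuclideanSpace ℝ (Fin d)) := P.punct '' S.tiles

/-- The puncture of one tile would lie in the interior of the other, against disjointness of
interiors. This is the source of all rigidity below. -/
theorem Tiling.eq_of_norm_punct_lt (S : Tiling P) {t t' : Tile d ι} (ht : t ∈ S.tiles)
    (ht' : t' ∈ S.tiles) (h : ‖P.punct t - P.punct t'‖ < P.inr) : t = t' := by
  by_contra hne
  refine Set.disjoint_left.1 (S.disjoint t ht t' ht' hne) (punct_mem_interior P t)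
    (ball_punct_subset P t' ?_)
  rwa [mem_ball, dist_eq_norm]

theorem Tiling.pairwiseSep_puncts (S : Tiling P) : PairwiseSep P.inr S.puncts := by
  rintro _ ⟨t, ht, rfl⟩ _ ⟨t', ht', rfl⟩ h
  rw [S.eq_of_norm_punct_lt ht ht' h]

theorem Tiling.injOn_punct (S : Tiling P) : Set.InjOn P.punct S.tiles := fun t ht t' ht' h =>
  S.eq_of_norm_punct_lt ht ht' (by rw [h, sub_self, norm_zero]; exact P.inr_pos)

theorem Tiling.puncts_translate (S : Tiling P) (x : EuclideanSpace ℝ (Fin d)) :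
    (S.translate x).puncts = (fun y => y + x) '' S.puncts := by
  simp only [Tiling.puncts, Tiling.translate, translateTiles, Set.image_image, punct_translate]

theorem Tiling.mem_puncts_translate {S : Tiling P} {x y : EuclideanSpace ℝ (Fin d)} :
    y ∈ (S.translate x).puncts ↔ y - x ∈ S.puncts := by
  rw [Tiling.puncts_translate]
  constructor
  · rintro ⟨z, hz, rfl⟩; simpa using hz
  · exact fun h => ⟨_, h, by simp⟩

theorem Tiling.exists_tile (S : Tiling P) (x : EuclideanSpace ℝ (Fin d)) :
    ∃ t ∈ S.tiles, x ∈ P.support t := by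
  have h : x ∈ ⋃ t ∈ S.tiles, P.support t := by rw [S.cover]; trivial
  obtain ⟨t, ht, hx⟩ := mem_iUnion₂.1 h
  exact ⟨t, ht, hx⟩

theorem Tiling.exists_punct_near (S : Tiling P) (x : EuclideanSpace ℝ (Fin d)) :
    ∃ p ∈ S.puncts, ‖x - p‖ ≤ P.outr := by
  obtain ⟨t, ht, hx⟩ := S.exists_tile x
  exact ⟨_, ⟨t, ht, rfl⟩, norm_sub_punct_le hx⟩

theorem Tiling.norm_punct_of_mem_ballPatch {S : Tiling P} {x : EuclideanSpace ℝ (Fin d)} {r : ℝ}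
    {t : Tile d ι} (ht : t ∈ S.ballPatch x r) : ‖P.punct t - x‖ < r + P.outr := by
  obtain ⟨_, y, hy, hb⟩ := ht
  rw [mem_ball, dist_eq_norm] at hb
  have h1 := norm_sub_punct_le hy
  rw [norm_sub_rev] at h1
  have := norm_sub_le_norm_sub_add_norm_sub (P.punct t) y x
  linarith

theorem Tiling.mem_ballPatch_of_norm_punct {S : Tiling P} {x : EuclideanSpace ℝ (Fin d)} {r : ℝ}
    {t : Tile d ι} (ht : t ∈ S.tiles) (h : ‖P.punct t - x‖ < r) : t ∈ S.ballPatch x r :=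
  ⟨ht, P.punct t, punct_mem_support P t, by rwa [mem_ball, dist_eq_norm]⟩

theorem Tiling.finite_ballPatch (S : Tiling P) (x : EuclideanSpace ℝ (Fin d)) (r : ℝ) :
    (S.ballPatch x r).Finite := by
  refine Set.Finite.of_finite_image (f := P.punct) ?_ (S.injOn_punct.mono fun t ht => ht.1)
  refine (S.pairwiseSep_puncts.mono (A := P.punct '' S.ballPatch x r)
    (Set.image_mono fun t ht => ht.1)).finite_of_isBounded P.inr_pos
    ((isBounded_ball (x := x) (r := r + P.outr)).subset ?_)
  rintro _ ⟨t, ht, rfl⟩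
  rw [mem_ball, dist_eq_norm]
  exact S.norm_punct_of_mem_ballPatch ht

theorem Tiling.ball_subset_ballPatch (S : Tiling P) (x : EuclideanSpace ℝ (Fin d)) (r : ℝ) :
    ball x r ⊆ ⋃ t ∈ S.ballPatch x r, P.support t := by
  intro y hy
  obtain ⟨t, ht, hyt⟩ := S.exists_tile y
  exact mem_iUnion₂.2 ⟨t, ⟨ht, y, hyt, hy⟩, hyt⟩

/-- Repetitivity speaks only of connected patches. The tiles cover the ball, so their union is also
the union of the connected sets "tile together with ball", all of which contain `x`. -/
theorem Tiling.isPatch_ballPatch (S : Tiling P) (x : EuclideanSpace ℝ (Fin d)) {r : ℝ}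
    (hr : 0 < r) : S.IsPatch (S.ballPatch x r) := by
  refine ⟨fun t ht => ht.1, S.finite_ballPatch x r,
    ⟨x, S.ball_subset_ballPatch x r (mem_ball_self hr)⟩, ?_⟩
  have e : ⋃ t ∈ S.ballPatch x r, P.support t =
      ⋃₀ insert (ball x r) ((fun t => P.support t ∪ ball x r) '' S.ballPatch x r) := by
    rw [sUnion_insert, sUnion_image]
    refine Set.Subset.antisymm (fun y hy => ?_) (union_subset (S.ball_subset_ballPatch x r) ?_)
    · obtain ⟨t, ht, h⟩ := mem_iUnion₂.1 hy
      exact Or.inr (mem_iUnion₂.2 ⟨t, ht, Or.inl h⟩)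
    · refine iUnion₂_subset fun t ht => union_subset (fun y hy => mem_iUnion₂.2 ⟨t, ht, hy⟩)
        (S.ball_subset_ballPatch x r)
  have hball : IsPreconnected (ball x r) := (convex_ball x r).isPreconnected
  rw [e]
  refine isPreconnected_sUnion x _ ?_ ?_
  · rintro _ (rfl | ⟨t, _, rfl⟩)
    · exact mem_ball_self hr
    · exact Or.inr (mem_ball_self hr)
  · rintro _ (rfl | ⟨t, ht, rfl⟩)
    · exact hball
    · exact (isPreconnected_support P t).union' ht.2 hball

/-! ### Tilings that agree on a ball about the origin -/

/-- `S` and `S'` have the same tiles that meet the ball of radius `R` about the origin. -/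
def AgreeOn (R : ℝ) (S S' : Tiling P) : Prop := S.ballPatch 0 R = S'.ballPatch 0 R

theorem AgreeOn.symm {R : ℝ} {S S' : Tiling P} (h : AgreeOn R S S') : AgreeOn R S' S := Eq.symm h

theorem AgreeOn.trans {R : ℝ} {S S' S'' : Tiling P} (h : AgreeOn R S S')
    (h' : AgreeOn R S' S'') : AgreeOn R S S'' := Eq.trans h h'

theorem AgreeOn.translate {R r : ℝ} {S S' : Tiling P} (h : AgreeOn R S S')
    {y : EuclideanSpace ℝ (Fin d)} (hr : r + ‖y‖ ≤ R) :
    AgreeOn r (S.translate y) (S'.translate y) := ballPatch_translate_eq h hr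

theorem AgreeOn.mono {R r : ℝ} {S S' : Tiling P} (h : AgreeOn R S S') (hr : r ≤ R) :
    AgreeOn r S S' := by
  simpa only [Tiling.translate_zero] using h.translate (y := 0) (r := r) (by simpa using hr)

theorem AgreeOn.mem_tiles {R : ℝ} {S S' : Tiling P} (h : AgreeOn R S S') {t : Tile d ι}
    (ht : t ∈ S.tiles) (hR : (P.support t ∩ ball 0 R).Nonempty) : t ∈ S'.tiles :=
  ((Set.ext_iff.1 h t).1 ⟨ht, hR⟩).1

theorem AgreeOn.mem_tiles_of_punct {R : ℝ} {S S' : Tiling P} (h : AgreeOn R S S') {t : Tile d ι}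
    (ht : t ∈ S.tiles) (hR : ‖P.punct t‖ < R) : t ∈ S'.tiles :=
  h.mem_tiles ht ⟨P.punct t, punct_mem_support P t, by simpa using hR⟩

theorem AgreeOn.mem_puncts {R : ℝ} {S S' : Tiling P} (h : AgreeOn R S S')
    {x : EuclideanSpace ℝ (Fin d)} (hx : x ∈ S.puncts) (hR : ‖x‖ < R) : x ∈ S'.puncts := by
  obtain ⟨t, ht, rfl⟩ := hx
  exact ⟨t, h.mem_tiles_of_punct ht hR, rfl⟩

theorem dist_le_of_agreeOn {R : ℝ} (hR : 0 < R) {S S' : Tiling P} (h : AgreeOn R S S') :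
    dist S S' ≤ R⁻¹ := by
  refine tilingDist_le_of_close (inv_pos.2 hR) ⟨0, 0, ?_, ?_, ?_⟩
  · simpa using hR.le
  · simpa using hR.le
  · rw [Tiling.translate_zero, Tiling.translate_zero, inv_inv]
    exact h

/-- Close tilings agree on a large ball up to a small translation. -/
theorem exists_agreeOn_translate_of_dist_lt {R η : ℝ} (hη : 0 < η) :
    ∃ ε : ℝ, 0 < ε ∧ ∀ S S' : Tiling P, dist S S' < ε →
      ∃ w : EuclideanSpace ℝ (Fin d), ‖w‖ ≤ η ∧ AgreeOn R S (S'.translate w) := by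
  -- Closeness moves both tilings by at most `ε`. The first bound controls the total shift by `η`;
  -- the other two leave agreement on radius `R` after undoing the shift of `S`.
  set ε := min (min (η / 2) 1) (|R| + 1)⁻¹ with hε
  have h1 : ε ≤ η / 2 := (min_le_left _ _).trans (min_le_left _ _)
  have h2 : ε ≤ 1 := (min_le_left _ _).trans (min_le_right _ _)
  have h3 : ε ≤ (|R| + 1)⁻¹ := min_le_right _ _
  have h0 : 0 < ε := by positivity
  have h4 : |R| + 1 ≤ ε⁻¹ := by simpa using inv_anti₀ h0 h3
  refine ⟨ε, h0, fun S S' h => ?_⟩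
  obtain ⟨x₁, x₂, hx₁, hx₂, he⟩ := epsClose_of_dist_lt h h2
  refine ⟨x₂ + -x₁, ?_, ?_⟩
  · have := norm_add_le x₂ (-x₁)
    rw [norm_neg] at this
    linarith
  · have := AgreeOn.translate (r := R) (y := -x₁) he (by
      rw [norm_neg]; linarith [le_abs_self R])
    rwa [Tiling.translate_translate, Tiling.translate_translate, add_neg_cancel,
      Tiling.translate_zero] at this

end Tiling
end TilingGroupoid

namespace TilingGroupoid

open Metric Set Filter Topology
section Tiling

variable {d : ℕ} {ι : Type*} [Finite ι] {P : PrototileSet d ι} {T : Tiling P}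

/-! ### The hull -/

theorem Tiling.ballPatch_translate (S : Tiling P) (x y : EuclideanSpace ℝ (Fin d)) (r : ℝ) :
    (S.translate x).ballPatch (y + x) r = translateTiles (S.ballPatch y r) x := by
  ext t
  constructor
  · intro ht
    obtain ⟨t', ht', rfl⟩ := ht.1
    exact ⟨t', mem_ballPatch_translate.1 ht, rfl⟩
  · rintro ⟨t', ht', rfl⟩
    exact mem_ballPatch_translate.2 ht'

/-- The small shift allowed by the metric is absorbed into the orbit, so approximation becomes exact
agreement on balls. -/
theorem Tiling.mem_hull_iff {S : Tiling P} :
    S ∈ T.hull ↔ ∀ R : ℝ, 0 < R → ∃ w, AgreeOn R S (T.translate w) := by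
  unfold Tiling.hull
  rw [Metric.mem_closure_iff]
  constructor
  · intro h R _
    obtain ⟨ε, hε, hc⟩ := exists_agreeOn_translate_of_dist_lt (P := P) (R := R) one_pos
    obtain ⟨_, ⟨x, rfl⟩, hx⟩ := h ε hε
    obtain ⟨w, _, hw⟩ := hc _ _ hx
    exact ⟨x + w, by rwa [Tiling.translate_translate] at hw⟩
  · intro h ε hε
    obtain ⟨w, hw⟩ := h (ε / 2)⁻¹ (by positivity)
    refine ⟨_, ⟨w, rfl⟩, (dist_le_of_agreeOn (by positivity) hw).trans_lt ?_⟩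
    rw [inv_inv]; linarith

theorem Tiling.translate_mem_hull {S : Tiling P} (hS : S ∈ T.hull)
    (x : EuclideanSpace ℝ (Fin d)) : S.translate x ∈ T.hull := by
  rw [Tiling.mem_hull_iff] at hS ⊢
  intro R hR
  obtain ⟨w, hw⟩ := hS (R + ‖x‖) (by positivity)
  exact ⟨w + x, by simpa only [Tiling.translate_translate] using hw.translate (y := x) le_rfl⟩

theorem Tiling.self_mem_hull (T : Tiling P) : T ∈ T.hull :=
  subset_closure ⟨0, Tiling.translate_zero T⟩

theorem DiscreteHull.zero_mem_puncts (S : DiscreteHull T) : (0 : EuclideanSpace ℝ (Fin d)) ∈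
    S.1.puncts := S.2.2

/-- The translate `S - v` of a tiling `S` with puncture `v`. -/
def DiscreteHull.shift (S : DiscreteHull T) (v : EuclideanSpace ℝ (Fin d)) (hv : v ∈ S.1.puncts) :
    DiscreteHull T :=
  ⟨S.1.translate (-v), Tiling.translate_mem_hull S.2.1 _, show (0 : EuclideanSpace ℝ (Fin d)) ∈
    (S.1.translate (-v)).puncts from Tiling.mem_puncts_translate.2 (by simpa using hv)⟩

instance (T : Tiling P) : Nonempty (DiscreteHull T) := by
  obtain ⟨p, hp, -⟩ := T.exists_punct_near 0
  exact ⟨⟨T.translate (-p), Tiling.translate_mem_hull T.self_mem_hull _,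
    show (0 : EuclideanSpace ℝ (Fin d)) ∈ (T.translate (-p)).puncts from
      Tiling.mem_puncts_translate.2 (by simpa using hp)⟩⟩

theorem finite_range_ballPatch (hflc : T.HasFLC) {R : ℝ} (hR : 0 < R) :
    (range fun S : DiscreteHull T => S.1.ballPatch 0 R).Finite := by
  obtain ⟨F, hF, hFT⟩ := hflc R hR
  -- A puncture at the origin pins down the translation: it is minus the puncture of some tile of
  -- the representative. Representatives with infinitely many tiles never occur and are discarded.
  refine (Set.Finite.biUnion (hF.inter_of_left {Q | Q.Finite})
    (t := fun Q => (fun q => translateTiles Q (-P.punct q)) '' Q)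
    fun Q hQ => hQ.2.image _).subset ?_
  rintro _ ⟨S, rfl⟩
  obtain ⟨w, hw⟩ := Tiling.mem_hull_iff.1 S.2.1 R hR
  obtain ⟨Q, hQ, y, hy⟩ := hFT (-w)
  have e : S.1.ballPatch 0 R = translateTiles Q (y + w) := by
    rw [hw, ← translateTiles_translateTiles, ← hy, ← Tiling.ballPatch_translate, neg_add_cancel]
  have hfin : Q.Finite := by
    have h := S.1.finite_ballPatch 0 R
    rw [e] at h
    refine Set.Finite.of_finite_image h fun a _ b _ hab => ?_
    simpa [Prod.ext_iff] using hab
  obtain ⟨t, ht, ht0⟩ := S.2.2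
  have htp : t ∈ S.1.ballPatch 0 R :=
    Tiling.mem_ballPatch_of_norm_punct ht (by rw [ht0]; simpa using hR)
  rw [e] at htp
  obtain ⟨q, hq, rfl⟩ := htp
  refine mem_iUnion₂.2 ⟨Q, ⟨hQ, hfin⟩, q, hq, ?_⟩
  have : y + w = -P.punct q := by
    rw [punct_translate] at ht0
    exact (neg_eq_of_add_eq_zero_right ht0).symm
  simp only [e, this]

/-! ### The topology of the discrete hull -/

/-- Closeness gives agreement up to a shift `w` shorter than `P.inr`. Both tilings have a puncture
at the origin, so `0` and `-w` are punctures of `S'`, and separation forces `w = 0`. -/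
theorem exists_agreeOn_of_dist_lt (T : Tiling P) (R : ℝ) :
    ∃ ε : ℝ, 0 < ε ∧ ∀ S S' : DiscreteHull T, dist S S' < ε → AgreeOn R S.1 S'.1 := by
  obtain ⟨ε, hε, h⟩ := exists_agreeOn_translate_of_dist_lt (P := P) (R := max R 1)
    (half_pos P.inr_pos)
  refine ⟨ε, hε, fun S S' hSS => ?_⟩
  obtain ⟨w, hw, ha⟩ := h S.1 S'.1 hSS
  have h1 := ha.mem_puncts S.zero_mem_puncts (by simp)
  rw [Tiling.mem_puncts_translate] at h1
  have h2 := S'.1.pairwiseSep_puncts _ h1 _ S'.zero_mem_puncts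
    (by simpa using hw.trans_lt (half_lt_self P.inr_pos))
  obtain rfl : w = 0 := by simpa using h2
  rw [Tiling.translate_zero] at ha
  exact ha.mono (le_max_left _ _)

theorem DiscreteHull.eventually_agreeOn (R : ℝ) (S : DiscreteHull T) :
    ∀ᶠ S' in 𝓝 S, AgreeOn R S'.1 S.1 := by
  obtain ⟨ε, hε, h⟩ := exists_agreeOn_of_dist_lt T R
  exact Metric.eventually_nhds_iff.2 ⟨ε, hε, fun S' hS' => h _ _ hS'⟩

theorem DiscreteHull.tendsto_of_agreeOn {α : Type*} {l : Filter α} {f : α → DiscreteHull T}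
    {S : DiscreteHull T} (h : ∀ R : ℝ, 0 < R → ∀ᶠ a in l, AgreeOn R (f a).1 S.1) :
    Tendsto f l (𝓝 S) := by
  rw [Metric.tendsto_nhds]
  intro ε hε
  filter_upwards [h (ε / 2)⁻¹ (by positivity)] with a ha
  refine (dist_le_of_agreeOn (by positivity) ha).trans_lt ?_
  rw [inv_inv]; linarith

theorem DiscreteHull.isClopen_of_agreeOn {A : Set (DiscreteHull T)} (R : ℝ)
    (h : ∀ S S' : DiscreteHull T, AgreeOn R S.1 S'.1 → S ∈ A → S' ∈ A) : IsClopen A := by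
  constructor
  · rw [← isOpen_compl_iff, isOpen_iff_mem_nhds]
    intro S hS
    filter_upwards [S.eventually_agreeOn R] with S' hS' hA
    exact hS (h _ _ hS' hA)
  · rw [isOpen_iff_mem_nhds]
    intro S hS
    filter_upwards [S.eventually_agreeOn R] with S' hS'
    exact h _ _ hS'.symm hS

/-- A sequence of tilings that stabilises on each ball has a limit. -/
theorem exists_limit_tiling (u : ℕ → Tiling P)
    (h : ∀ R : ℝ, 0 < R → ∃ N, ∀ n, N ≤ n → AgreeOn R (u n) (u N)) :
    ∃ S : Tiling P, ∀ R : ℝ, 0 < R → ∀ᶠ n in atTop, AgreeOn R (u n) S := by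
  refine ⟨⟨{t | ∀ᶠ n in atTop, t ∈ (u n).tiles}, ?_, ?_⟩, ?_⟩
  · rw [eq_univ_iff_forall]
    intro y
    obtain ⟨N, hN⟩ := h (‖y‖ + 1) (by positivity)
    obtain ⟨t, ht, hy⟩ := (u N).exists_tile y
    refine mem_iUnion₂.2 ⟨t, ?_, hy⟩
    filter_upwards [eventually_ge_atTop N] with n hn
    exact (hN n hn).symm.mem_tiles ht ⟨y, hy, by simp⟩
  · intro t ht t' ht' hne
    obtain ⟨n, h1, h2⟩ := (ht.and ht').exists
    exact (u n).disjoint t h1 t' h2 hne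
  · intro R hR
    obtain ⟨N, hN⟩ := h R hR
    filter_upwards [eventually_ge_atTop N] with n hn
    refine Set.ext fun t => ⟨fun ht => ⟨?_, ht.2⟩, fun ht => ⟨?_, ht.2⟩⟩
    · have htN := (hN n hn).mem_tiles ht.1 ht.2
      filter_upwards [eventually_ge_atTop N] with m hm
      exact (hN m hm).symm.mem_tiles htN ht.2
    · obtain ⟨m, hm, hm'⟩ := (ht.1.and (eventually_ge_atTop N)).exists
      exact ((hN m hm').trans (hN n hn).symm).mem_tiles hm ht.2

/-- A Cauchy sequence stabilises on every ball, so it converges to the tiling made of the tiles that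
are eventually present. -/
theorem DiscreteHull.completeSpace (T : Tiling P) : CompleteSpace (DiscreteHull T) := by
  refine Metric.complete_of_cauchySeq_tendsto fun u hu => ?_
  have hN : ∀ R : ℝ, 0 < R → ∃ N, ∀ n, N ≤ n → AgreeOn R (u n).1 (u N).1 := by
    intro R _
    obtain ⟨ε, hε, h⟩ := exists_agreeOn_of_dist_lt T R
    obtain ⟨N, hN⟩ := Metric.cauchySeq_iff'.1 hu ε hε
    exact ⟨N, fun n hn => h _ _ (hN n hn)⟩
  obtain ⟨S, hS⟩ := exists_limit_tiling (fun n => (u n).1) hN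
  have hhull : S ∈ T.hull := by
    rw [Tiling.mem_hull_iff]
    intro R hR
    obtain ⟨n, hn⟩ := (hS R hR).exists
    obtain ⟨w, hw⟩ := Tiling.mem_hull_iff.1 (u n).2.1 R hR
    exact ⟨w, hn.symm.trans hw⟩
  have h0 : (0 : EuclideanSpace ℝ (Fin d)) ∈ S.puncts := by
    obtain ⟨n, hn⟩ := (hS 1 one_pos).exists
    exact hn.mem_puncts (u n).zero_mem_puncts (by simp)
  exact ⟨⟨S, hhull, h0⟩, DiscreteHull.tendsto_of_agreeOn hS⟩

/-- Total boundedness: the patch of radius `(ε / 2)⁻¹` about the origin determines a tiling up to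
`ε`, and it takes finitely many values. -/
theorem DiscreteHull.compactSpace (hflc : T.HasFLC) : CompactSpace (DiscreteHull T) := by
  have := DiscreteHull.completeSpace T
  refine ⟨isCompact_iff_totallyBounded_isComplete.2 ⟨?_, completeSpace_iff_isComplete_univ.1 this⟩⟩
  refine Metric.totallyBounded_of_finite_discretization fun ε hε => ?_
  have hR : 0 < (ε / 2)⁻¹ := by positivity
  refine ⟨range fun S : DiscreteHull T => S.1.ballPatch 0 (ε / 2)⁻¹,
    (finite_range_ballPatch hflc hR).fintype, fun S => ⟨_, S.1, rfl⟩, fun S S' h => ?_⟩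
  refine (dist_le_of_agreeOn hR (Subtype.ext_iff.1 h)).trans_lt ?_
  rw [inv_inv]; linarith

end Tiling
end TilingGroupoid

namespace TilingGroupoid

open Metric Set Filter Topology

open ArrowGroupoid

/-! ### Open subgroupoids -/

/-- The units of `K` embed openly into those of `G`. Source and range of `K`, followed by this
embedding, are restrictions of local homeomorphisms to an open set, and the embedding can be
cancelled. -/
theorem Subgroupoid.isLCHEtale_of_isOpen {G : Type*} [ArrowGroupoid G] [TopologicalSpace G]
    (hG : IsLCHEtale G) (K : Subgroupoid G) (hK : IsOpen K.carrier) : IsLCHEtale K.carrier := by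
  have := hG.locallyCompact
  have := hG.hausdorff
  have hval : IsOpenEmbedding (Subtype.val : K.carrier → G) := hK.isOpenEmbedding_subtypeVal
  set j : units K.carrier → units G := fun u => ⟨u.1.1, congrArg Subtype.val u.2⟩ with hj
  have hjc : Continuous j := by fun_prop
  have hjo : IsOpenEmbedding j := by
    have hcomp : IsEmbedding (Subtype.val ∘ j) :=
      hval.isEmbedding.comp IsEmbedding.subtypeVal
    refine ⟨hcomp.of_comp hjc continuous_subtype_val, ?_⟩
    have : range j = Subtype.val ⁻¹' K.carrier := by
      ext u
      refine ⟨?_, fun hu => ⟨⟨⟨u.1, hu⟩, Subtype.ext u.2⟩, rfl⟩⟩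
      rintro ⟨v, rfl⟩
      exact v.1.2
    rw [this]
    exact hK.preimage continuous_subtype_val
  refine ⟨hK.locallyCompactSpace, inferInstance, ?_, ?_, ?_, ?_⟩
  · exact (hG.continuous_inv.comp continuous_subtype_val).subtype_mk _
  · refine Continuous.subtype_mk ?_ _
    exact hG.continuous_mul.comp
      (f := fun p : {p : K.carrier × K.carrier // src p.1 = rng p.2} =>
        (⟨(p.1.1.1, p.1.2.1), congrArg Subtype.val p.2⟩ : {p : G × G // src p.1 = rng p.2}))
      (by fun_prop)
  · refine IsLocalHomeomorph.of_comp (g := j)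
      (hG.etale_src.comp hval.isLocalHomeomorph) hjo.isLocalHomeomorph ?_
    refine Continuous.subtype_mk (Continuous.subtype_mk ?_ _) _
    exact continuous_subtype_val.comp (hG.etale_src.continuous.comp continuous_subtype_val)
  · refine IsLocalHomeomorph.of_comp (g := j)
      (hG.etale_rng.comp hval.isLocalHomeomorph) hjo.isLocalHomeomorph ?_
    refine Continuous.subtype_mk (Continuous.subtype_mk ?_ _) _
    exact continuous_subtype_val.comp (hG.etale_rng.continuous.comp continuous_subtype_val)

section Tiling

variable {d : ℕ} {ι : Type*} [Finite ι] {P : PrototileSet d ι} {T : Tiling P}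

/-! ### The displacement of an arrow -/

theorem RPunc.vec_mem (g : RPunc T) : g.vec ∈ g.fst.1.puncts := ⟨_, g.rel.choose_spec.1, rfl⟩

/-- Two displacements with the same ends differ by a period of a tiling in the hull. -/
theorem RPunc.vec_eq (haper : T.IsAperiodic) (g : RPunc T) {v : EuclideanSpace ℝ (Fin d)}
    (h : g.snd.1 = g.fst.1.translate (-v)) : g.vec = v := by
  have h1 := haper _ g.fst.2.1 (-g.vec + v) (by
    rw [← Tiling.translate_translate, ← g.snd_eq, h, Tiling.translate_translate, neg_add_cancel,
      Tiling.translate_zero])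
  rw [neg_add_eq_sub, sub_eq_zero] at h1
  exact h1.symm

theorem RPunc.fst_eq (g : RPunc T) : g.fst.1 = g.snd.1.translate g.vec := by
  rw [g.snd_eq, Tiling.translate_translate, neg_add_cancel, Tiling.translate_zero]

theorem RPunc.ext_vec {g h : RPunc T} (h1 : g.fst = h.fst) (h2 : g.vec = h.vec) : g = h :=
  RPunc.ext h1 (Subtype.ext (by rw [g.snd_eq, h.snd_eq, h1, h2]))

theorem RPunc.ext_vec_snd {g h : RPunc T} (h1 : g.snd = h.snd) (h2 : g.vec = h.vec) : g = h :=
  RPunc.ext (Subtype.ext (by rw [g.fst_eq, h.fst_eq, h1, h2])) h1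

theorem RPunc.neg_vec_mem (g : RPunc T) : -g.vec ∈ g.snd.1.puncts := by
  rw [g.snd_eq, Tiling.mem_puncts_translate, sub_self]
  exact g.fst.zero_mem_puncts

/-- The arrow `(S, S - v)`. -/
def RPunc.arrow (S : DiscreteHull T) (v : EuclideanSpace ℝ (Fin d)) (hv : v ∈ S.1.puncts) :
    RPunc T :=
  ⟨S, S.shift v hv, by
    obtain ⟨t, ht, rfl⟩ := hv
    exact ⟨t, ht, rfl⟩⟩

theorem RPunc.vec_arrow (haper : T.IsAperiodic) (S : DiscreteHull T)
    {v : EuclideanSpace ℝ (Fin d)} (hv : v ∈ S.1.puncts) : (RPunc.arrow S v hv).vec = v :=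
  RPunc.vec_eq haper _ rfl

theorem RPunc.vec_inv (haper : T.IsAperiodic) (g : RPunc T) : (inv g).vec = -g.vec :=
  RPunc.vec_eq haper _ (by rw [neg_neg]; exact g.fst_eq)

theorem RPunc.vec_mul (haper : T.IsAperiodic) (g h : RPunc T) (e : src g = rng h) :
    (mul g h e).vec = g.vec + h.vec := by
  refine RPunc.vec_eq haper _ ?_
  have e' : g.snd = h.fst := congrArg RPunc.fst e
  change h.snd.1 = g.fst.1.translate _
  rw [h.snd_eq, ← e', g.snd_eq, Tiling.translate_translate, neg_add]

theorem RPunc.vec_unit (haper : T.IsAperiodic) {g : RPunc T} (hg : g.snd = g.fst) : g.vec = 0 :=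
  RPunc.vec_eq haper _ (by rw [hg, neg_zero, Tiling.translate_zero])

/-! ### The topology of the tiling groupoid -/

theorem RPunc.dist_def (g h : RPunc T) : dist g h = dist g.fst h.fst + ‖g.vec - h.vec‖ := rfl

theorem RPunc.continuous_fst : Continuous (RPunc.fst : RPunc T → DiscreteHull T) :=
  (LipschitzWith.of_dist_le' (K := 1) fun g h => by
    rw [RPunc.dist_def, one_mul]; linarith [norm_nonneg (g.vec - h.vec)]).continuous

theorem RPunc.continuous_vec : Continuous (RPunc.vec : RPunc T → EuclideanSpace ℝ (Fin d)) :=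
  (LipschitzWith.of_dist_le' (K := 1) fun g h => by
    rw [RPunc.dist_def, one_mul, dist_eq_norm]
    linarith [dist_nonneg (x := g.fst) (y := h.fst)]).continuous

/-- Local constancy of the displacement: for `h` near `g`, both `g.vec` and `h.vec` are punctures of
`h.fst` at distance less than `P.inr`. -/
theorem RPunc.eventually_agreeOn (R : ℝ) (g : RPunc T) :
    ∀ᶠ h in 𝓝 g, h.vec = g.vec ∧ AgreeOn R h.fst.1 g.fst.1 := by
  have h1 := RPunc.continuous_fst.continuousAt.eventually
    (g.fst.eventually_agreeOn (max R (‖g.vec‖ + 1)))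
  have h2 := RPunc.continuous_vec.continuousAt.eventually (Metric.ball_mem_nhds g.vec P.inr_pos)
  filter_upwards [h1, h2] with h h1 h2
  refine ⟨?_, h1.mono (le_max_left _ _)⟩
  refine h.fst.1.pairwiseSep_puncts _ h.vec_mem _ ?_ (by rwa [← dist_eq_norm])
  exact h1.symm.mem_puncts g.vec_mem (lt_of_lt_of_le (by linarith) (le_max_right _ _))

theorem RPunc.isClopen_of_agreeOn {A : Set (RPunc T)} (R : ℝ)
    (h : ∀ g g' : RPunc T, g.vec = g'.vec → AgreeOn R g.fst.1 g'.fst.1 → g ∈ A → g' ∈ A) :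
    IsClopen A := by
  constructor
  · rw [← isOpen_compl_iff, isOpen_iff_mem_nhds]
    intro g hg
    filter_upwards [g.eventually_agreeOn R] with g' hg' hA
    exact hg (h _ _ hg'.1 hg'.2 hA)
  · rw [isOpen_iff_mem_nhds]
    intro g hg
    filter_upwards [g.eventually_agreeOn R] with g' hg'
    exact h _ _ hg'.1.symm hg'.2.symm hg

theorem RPunc.isClopen_vec_eq (v : EuclideanSpace ℝ (Fin d)) :
    IsClopen {g : RPunc T | g.vec = v} :=
  RPunc.isClopen_of_agreeOn 0 fun _ _ h _ hg => h.symm.trans hg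

theorem RPunc.tendsto_of {α : Type*} {l : Filter α} {f : α → RPunc T} {g : RPunc T}
    (h1 : Tendsto (fun a => (f a).fst) l (𝓝 g.fst)) (h2 : ∀ᶠ a in l, (f a).vec = g.vec) :
    Tendsto f l (𝓝 g) := by
  rw [tendsto_iff_dist_tendsto_zero] at h1 ⊢
  refine h1.congr' ?_
  filter_upwards [h2] with a ha
  rw [RPunc.dist_def, ha, sub_self, norm_zero, add_zero]

theorem RPunc.continuous_snd : Continuous (RPunc.snd : RPunc T → DiscreteHull T) := by
  refine continuous_iff_continuousAt.2 fun g => DiscreteHull.tendsto_of_agreeOn fun R _ => ?_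
  filter_upwards [g.eventually_agreeOn (R + ‖g.vec‖)] with h hh
  rw [g.snd_eq, h.snd_eq, hh.1]
  exact hh.2.translate (by rw [norm_neg])

theorem RPunc.continuous_inv (haper : T.IsAperiodic) : Continuous (inv : RPunc T → RPunc T) := by
  refine continuous_iff_continuousAt.2 fun g => RPunc.tendsto_of
    RPunc.continuous_snd.continuousAt ?_
  filter_upwards [g.eventually_agreeOn 1] with h hh
  rw [RPunc.vec_inv haper, RPunc.vec_inv haper, hh.1]

theorem RPunc.continuous_mul (haper : T.IsAperiodic) : Continuous
    (fun p : {p : RPunc T × RPunc T // src p.1 = rng p.2} => mul p.1.1 p.1.2 p.2) := by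
  refine continuous_iff_continuousAt.2 fun p => RPunc.tendsto_of ?_ ?_
  · exact (RPunc.continuous_fst.comp
      (_root_.continuous_fst.comp continuous_subtype_val)).continuousAt
  · have h1 := (_root_.continuous_fst.comp continuous_subtype_val).continuousAt.eventually
      (p.1.1.eventually_agreeOn 1)
    have h2 := (_root_.continuous_snd.comp continuous_subtype_val).continuousAt.eventually
      (p.1.2.eventually_agreeOn 1)
    filter_upwards [h1, h2] with q h1 h2
    rw [RPunc.vec_mul haper, RPunc.vec_mul haper]
    exact congrArg₂ (· + ·) h1.1 h2.1

/-- The unit space of the tiling groupoid is the discrete hull. -/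
def RPunc.unitHomeomorph (haper : T.IsAperiodic) : units (RPunc T) ≃ₜ DiscreteHull T where
  toFun u := u.1.fst
  invFun S := ⟨⟨S, S, RPunc.rel_refl S⟩, rfl⟩
  left_inv u := Subtype.ext (RPunc.ext rfl (congrArg RPunc.fst u.2.symm))
  right_inv _ := rfl
  continuous_toFun := RPunc.continuous_fst.comp continuous_subtype_val
  continuous_invFun := by
    refine Continuous.subtype_mk (continuous_iff_continuousAt.2 fun S =>
      RPunc.tendsto_of (f := fun S => ⟨S, S, RPunc.rel_refl S⟩) tendsto_id
        (Eventually.of_forall fun S' => ?_)) _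
    rw [RPunc.vec_unit haper rfl, RPunc.vec_unit haper rfl]

theorem DiscreteHull.isClopen_mem_puncts (v : EuclideanSpace ℝ (Fin d)) :
    IsClopen {S : DiscreteHull T | v ∈ S.1.puncts} :=
  DiscreteHull.isClopen_of_agreeOn (‖v‖ + 1) fun _ _ h hv => h.mem_puncts hv (by simp)

/-- Where the displacement is a constant `v`, the metric of the groupoid reduces to that of the
hull, so `fst` is an isometry onto the clopen set of tilings with puncture `v`. -/
theorem RPunc.isLocalHomeomorph_fst (haper : T.IsAperiodic) :
    IsLocalHomeomorph (RPunc.fst : RPunc T → DiscreteHull T) := by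
  refine isLocalHomeomorph_iff_isOpenEmbedding_restrict.2 fun g =>
    ⟨{h | h.vec = g.vec}, (RPunc.isClopen_vec_eq g.vec).isOpen.mem_nhds rfl, ?_⟩
  have hiso : Isometry (Set.domRestrict {h : RPunc T | h.vec = g.vec} RPunc.fst) := by
    refine Isometry.of_dist_eq fun a b => ?_
    have ha : a.1.vec = g.vec := a.2
    have hb : b.1.vec = g.vec := b.2
    rw [Subtype.dist_eq a b, RPunc.dist_def, ha, hb, sub_self, norm_zero, add_zero]
    rfl
  refine ⟨hiso.isEmbedding, ?_⟩
  have : range (Set.domRestrict {h : RPunc T | h.vec = g.vec} RPunc.fst) =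
      {S : DiscreteHull T | g.vec ∈ S.1.puncts} := by
    ext S
    constructor
    · rintro ⟨⟨h, hh⟩, rfl⟩
      have := h.vec_mem
      rwa [show h.vec = g.vec from hh] at this
    · exact fun hS => ⟨⟨RPunc.arrow S g.vec hS, RPunc.vec_arrow haper S hS⟩, rfl⟩
  rw [this]
  exact (DiscreteHull.isClopen_mem_puncts g.vec).isOpen

theorem RPunc.isCompact_vec_eq (haper : T.IsAperiodic) (hflc : T.HasFLC)
    (v : EuclideanSpace ℝ (Fin d)) : IsCompact {g : RPunc T | g.vec = v} := by
  have := DiscreteHull.compactSpace hflc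
  have := isCompact_iff_compactSpace.1
    (DiscreteHull.isClopen_mem_puncts (T := T) v).isClosed.isCompact
  have hc : Continuous fun S : {S : DiscreteHull T | v ∈ S.1.puncts} => RPunc.arrow S.1 v S.2 := by
    refine continuous_iff_continuousAt.2 fun S =>
      RPunc.tendsto_of continuousAt_subtype_val (Eventually.of_forall fun S' => ?_)
    rw [RPunc.vec_arrow haper, RPunc.vec_arrow haper]
  convert isCompact_range hc
  ext g
  constructor
  · rintro rfl
    exact ⟨⟨g.fst, g.vec_mem⟩, RPunc.ext_vec rfl (RPunc.vec_arrow haper _ _)⟩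
  · rintro ⟨S, rfl⟩
    exact RPunc.vec_arrow haper _ _

theorem RPunc.isGSet_of_vec_eq {V : Set (RPunc T)} (v : EuclideanSpace ℝ (Fin d))
    (hV : ∀ g ∈ V, g.vec = v) : IsGSet V := by
  refine ⟨fun g hg h hh e => ?_, fun g hg h hh e => ?_⟩
  · exact RPunc.ext_vec (congrArg (fun u => u.1.fst) e) ((hV g hg).trans (hV h hh).symm)
  · exact RPunc.ext_vec_snd (congrArg (fun u => u.1.fst) e) ((hV g hg).trans (hV h hh).symm)

theorem RPunc.isLCHEtale (haper : T.IsAperiodic) (hflc : T.HasFLC) : IsLCHEtale (RPunc T) := by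
  have hrng : IsLocalHomeomorph (rngMap (G := RPunc T)) :=
    (RPunc.unitHomeomorph haper).symm.isLocalHomeomorph.comp (RPunc.isLocalHomeomorph_fst haper)
  refine ⟨?_, inferInstance, RPunc.continuous_inv haper, RPunc.continuous_mul haper, ?_, hrng⟩
  · have : WeaklyLocallyCompactSpace (RPunc T) := ⟨fun g => ⟨_, RPunc.isCompact_vec_eq haper hflc
      g.vec, (RPunc.isClopen_vec_eq g.vec).isOpen.mem_nhds rfl⟩⟩
    infer_instance
  -- The source map is the range map after inversion, which is a homeomorphism.
  · let e : RPunc T ≃ₜ RPunc T :=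
      { toFun := inv
        invFun := inv
        left_inv := fun _ => rfl
        right_inv := fun _ => rfl
        continuous_toFun := RPunc.continuous_inv haper
        continuous_invFun := RPunc.continuous_inv haper }
    exact hrng.comp e.isLocalHomeomorph

theorem RPunc.exists_compact_open_gset (haper : T.IsAperiodic) (hflc : T.HasFLC) (g : RPunc T) :
    ∃ V : Set (RPunc T), IsCompact V ∧ IsOpen V ∧ IsGSet V ∧ g ∈ V :=
  ⟨_, RPunc.isCompact_vec_eq haper hflc g.vec, (RPunc.isClopen_vec_eq g.vec).isOpen,
    RPunc.isGSet_of_vec_eq g.vec fun _ h => h, rfl⟩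

end Tiling
end TilingGroupoid

namespace TilingGroupoid

open Metric Set Filter Topology

open ArrowGroupoid

section Tiling

variable {d : ℕ} {ι : Type*} [Finite ι] {P : PrototileSet d ι} {T : Tiling P}

/-! ### Locally determined functions on the discrete hull -/

theorem finite_range_of_agreeOn (hflc : T.HasFLC) {α : Type*} {f : DiscreteHull T → α} (R : ℝ)
    (h : ∀ S S' : DiscreteHull T, AgreeOn R S.1 S'.1 → f S = f S') : (range f).Finite := by
  have hfin := finite_range_ballPatch hflc (R := max R 1) (by positivity)
  choose g hg using fun Q : range fun S : DiscreteHull T => S.1.ballPatch 0 (max R 1) => Q.2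
  have := hfin.to_subtype
  refine (Set.finite_range fun Q => f (g Q)).subset ?_
  rintro _ ⟨S, rfl⟩
  refine ⟨⟨_, S, rfl⟩, h _ _ (AgreeOn.mono ?_ (le_max_left R 1))⟩
  exact hg ⟨_, S, rfl⟩

/-- A locally determined choice of a puncture (the centre of the cell of the origin). -/
structure CentreMap (T : Tiling P) where
  centre : DiscreteHull T → EuclideanSpace ℝ (Fin d)
  centre_mem : ∀ S, centre S ∈ S.1.puncts
  radius : ℝ
  radius_nonneg : 0 ≤ radius
  centre_eq : ∀ S S' : DiscreteHull T, AgreeOn radius S.1 S'.1 → centre S = centre S'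

/-! ### The elementary subgroupoid of a centre map. -/

namespace CentreMap

variable (κ : CentreMap T)

theorem isLocallyConstant_centre : IsLocallyConstant κ.centre := by
  refine (IsLocallyConstant.iff_eventually_eq _).2 fun S => ?_
  filter_upwards [S.eventually_agreeOn κ.radius] with S' hS'
  exact κ.centre_eq _ _ hS'

theorem finite_range_centre (hflc : T.HasFLC) : (range κ.centre).Finite :=
  finite_range_of_agreeOn hflc κ.radius κ.centre_eq

/-- The arrows between positions in the same cell. -/
def subgroupoid (haper : T.IsAperiodic) : Subgroupoid (RPunc T) where
  carrier := {g | κ.centre g.snd + g.vec = κ.centre g.fst}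
  inv_mem g hg := by
    have hg : κ.centre g.snd + g.vec = κ.centre g.fst := hg
    change κ.centre g.fst + (inv g).vec = κ.centre g.snd
    rw [RPunc.vec_inv haper, ← hg, add_neg_cancel_right]
  mul_mem g hg h hh e := by
    have hg : κ.centre g.snd + g.vec = κ.centre g.fst := hg
    have hh : κ.centre h.snd + h.vec = κ.centre h.fst := hh
    have e' : g.snd = h.fst := congrArg RPunc.fst e
    change κ.centre h.snd + (mul g h e).vec = κ.centre g.fst
    rw [RPunc.vec_mul haper, ← hg, e', ← hh]
    abel

variable (haper : T.IsAperiodic)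

theorem mem_subgroupoid {g : RPunc T} :
    g ∈ (κ.subgroupoid haper).carrier ↔ κ.centre g.snd + g.vec = κ.centre g.fst := Iff.rfl

theorem units_subset_subgroupoid : units (RPunc T) ⊆ (κ.subgroupoid haper).carrier := by
  intro g hg
  have h : g.snd = g.fst := congrArg RPunc.fst hg
  rw [mem_subgroupoid, RPunc.vec_unit haper h, h, add_zero]

theorem isClopen_subgroupoid : IsClopen (κ.subgroupoid haper).carrier := by
  have h1 : IsLocallyConstant fun g : RPunc T => κ.centre g.snd :=
    κ.isLocallyConstant_centre.comp_continuous RPunc.continuous_snd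
  have h2 : IsLocallyConstant fun g : RPunc T => κ.centre g.fst :=
    κ.isLocallyConstant_centre.comp_continuous RPunc.continuous_fst
  have h3 : IsLocallyConstant (RPunc.vec : RPunc T → EuclideanSpace ℝ (Fin d)) := by
    refine (IsLocallyConstant.iff_eventually_eq _).2 fun g => ?_
    filter_upwards [g.eventually_agreeOn 0] with h hh
    exact hh.1
  convert ((h1.add h3).sub h2).isClopen_fiber 0 using 1
  ext g
  exact sub_eq_zero.symm

/-- The displacement of an arrow inside a cell is a difference of two centres, so only finitely many
of the compact sets of constant displacement are involved. -/
theorem isCompact_subgroupoid (hflc : T.HasFLC) : IsCompact (κ.subgroupoid haper).carrier := by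
  have hfin := (κ.finite_range_centre hflc).sub (κ.finite_range_centre hflc)
  refine (hfin.isCompact_biUnion fun v _ => RPunc.isCompact_vec_eq haper hflc v).of_isClosed_subset
    (κ.isClopen_subgroupoid haper).isClosed fun g hg => ?_
  refine mem_iUnion₂.2 ⟨g.vec, ⟨κ.centre g.fst, ⟨_, rfl⟩, κ.centre g.snd, ⟨_, rfl⟩, ?_⟩, rfl⟩
  rw [mem_subgroupoid] at hg
  simp [← hg]

/-! ### Labels, positions and the fundamental domain. -/

/-- The tiling `S`, moved so that the centre of the cell of the origin is at the origin. -/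
def centred (S : DiscreteHull T) : DiscreteHull T := S.shift (κ.centre S) (κ.centre_mem S)

/-- The patch of radius `r` about the centre of the cell of the origin. -/
def label (r : ℝ) (S : DiscreteHull T) : Set (Tile d ι) := (κ.centred S).1.ballPatch 0 r

/-- The tilings with a given label and a given centre. -/
def piece (r : ℝ) (Q : Set (Tile d ι)) (c : EuclideanSpace ℝ (Fin d)) : Set (DiscreteHull T) :=
  {S | κ.label r S = Q ∧ κ.centre S = c}

theorem isLocallyConstant_label (r : ℝ) : IsLocallyConstant (κ.label r) := by
  refine (IsLocallyConstant.iff_eventually_eq _).2 fun S => ?_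
  -- The first radius fixes the centre, the second fixes the patch about it.
  filter_upwards [S.eventually_agreeOn (max κ.radius (r + ‖κ.centre S‖))] with S' hS'
  have h : κ.centre S' = κ.centre S := κ.centre_eq _ _ (hS'.mono (le_max_left _ _))
  change (S'.1.translate (-κ.centre S')).ballPatch 0 r = (S.1.translate (-κ.centre S)).ballPatch 0 r
  rw [h]
  exact (hS'.mono (le_max_right _ _)).translate (by rw [norm_neg])

theorem isClopen_piece (r : ℝ) (Q : Set (Tile d ι)) (c : EuclideanSpace ℝ (Fin d)) :
    IsClopen (κ.piece r Q c) :=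
  ((κ.isLocallyConstant_label r).isClopen_fiber Q).inter
    (κ.isLocallyConstant_centre.isClopen_fiber c)

theorem finite_range_label (hflc : T.HasFLC) {r : ℝ} (hr : 0 < r) : (range (κ.label r)).Finite :=
  (finite_range_ballPatch hflc hr).subset (by rintro _ ⟨S, rfl⟩; exact ⟨κ.centred S, rfl⟩)

variable {κ haper}

/-- The two ends of an arrow inside a cell become the same tiling once the centre is moved to the
origin. -/
theorem label_snd_eq {g : RPunc T} (hg : g ∈ (κ.subgroupoid haper).carrier) (r : ℝ) :
    κ.label r g.snd = κ.label r g.fst := by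
  rw [mem_subgroupoid] at hg
  have : κ.centred g.snd = κ.centred g.fst := by
    refine Subtype.ext ?_
    change g.snd.1.translate (-κ.centre g.snd) = g.fst.1.translate (-κ.centre g.fst)
    rw [g.snd_eq, Tiling.translate_translate, ← hg, neg_add, add_comm]
  simp only [label, this]

/-- Each tiling is connected in its cell with all positions that occur for its label. -/
theorem exists_arrow {r : ℝ} (hr : ∀ S, κ.radius + ‖κ.centre S‖ < r) {S S' : DiscreteHull T}
    (h : κ.label r S = κ.label r S') :
    ∃ g ∈ (κ.subgroupoid haper).carrier, g.fst = S ∧ κ.centre g.snd = κ.centre S' := by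
  have hag : AgreeOn r (S'.1.translate (-κ.centre S')) (S.1.translate (-κ.centre S)) := h.symm
  have h1 : -κ.centre S' ∈ (S'.1.translate (-κ.centre S')).puncts := by
    rw [Tiling.mem_puncts_translate, sub_self]; exact S'.zero_mem_puncts
  -- Seen from the centre, the origin of `S'` sits at `-κ.centre S'`. The common label has a
  -- puncture there, so `S` has one at `κ.centre S - κ.centre S'`.
  have h2 := hag.mem_puncts h1 (by
    rw [norm_neg]; linarith [hr S', κ.radius_nonneg])
  rw [Tiling.mem_puncts_translate, neg_sub_neg] at h2
  -- The label also covers the ball of radius `κ.radius` about this puncture, and that ball decides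
  -- the centre.
  have hsnd : κ.centre (RPunc.arrow S _ h2).snd = κ.centre S' := by
    refine κ.centre_eq _ _ ?_
    have h3 := (hag.translate (y := κ.centre S') (r := κ.radius) (hr S').le).symm
    rw [Tiling.translate_translate, Tiling.translate_translate, neg_add_cancel,
      Tiling.translate_zero] at h3
    change AgreeOn _ (S.1.translate (-(κ.centre S - κ.centre S'))) _
    rwa [neg_sub, sub_eq_neg_add]
  refine ⟨RPunc.arrow S _ h2, ?_, rfl, hsnd⟩
  rw [mem_subgroupoid, hsnd, RPunc.vec_arrow haper, add_sub_cancel]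
  rfl

/-- Tilings in one piece agree on radius `r` about a common centre `c`; moving back by `c` leaves
agreement on radius `η⁻¹` about the origin. -/
theorem ediam_piece_le {r η : ℝ} (hη : 0 < η) (hr : ∀ S, η⁻¹ + ‖κ.centre S‖ ≤ r)
    (Q : Set (Tile d ι)) (c : EuclideanSpace ℝ (Fin d)) :
    ediam (κ.piece r Q c) ≤ ENNReal.ofReal η := by
  refine Metric.ediam_le fun S hS S' hS' => ?_
  rw [edist_dist]
  refine ENNReal.ofReal_le_ofReal ?_
  have hag : AgreeOn r (S.1.translate (-κ.centre S)) (S'.1.translate (-κ.centre S')) :=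
    hS.1.trans hS'.1.symm
  have h2 := hag.translate (y := κ.centre S) (r := η⁻¹) (hr S)
  rw [Tiling.translate_translate, Tiling.translate_translate, neg_add_cancel,
    Tiling.translate_zero, hS.2, hS'.2, neg_add_cancel, Tiling.translate_zero] at h2
  have h3 := dist_le_of_agreeOn (inv_pos.2 hη) h2
  rwa [inv_inv] at h3

variable (κ haper)

/-- The positions of the origin in the cells with a given label. -/
def positions (r : ℝ) (Q : Set (Tile d ι)) : Set (EuclideanSpace ℝ (Fin d)) :=
  {c | ∃ S, κ.label r S = Q ∧ κ.centre S = c}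

theorem finite_positions (hflc : T.HasFLC) (r : ℝ) (Q : Set (Tile d ι)) :
    Finite (κ.positions r Q) :=
  ((κ.finite_range_centre hflc).subset (by rintro _ ⟨S, -, rfl⟩; exact ⟨S, rfl⟩)).to_subtype

theorem continuous_unitTiling (K : Subgroupoid (RPunc T)) : Continuous (unitTiling K) :=
  RPunc.continuous_fst.comp (continuous_subtype_val.comp continuous_subtype_val)

/-- The decomposition of the groupoid of a centre map according to labels and positions. -/
theorem exists_decomposition (hflc : T.HasFLC) {r : ℝ} (hr0 : 0 < r)
    (hr : ∀ S, κ.radius + ‖κ.centre S‖ < r) :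
    ∃ Φ : FundamentalDecomposition (κ.subgroupoid haper).carrier, ∀ i j, ∃ Q c,
      unitTiling (κ.subgroupoid haper) '' Φ.F i j ⊆ κ.piece r Q c := by
  have := (κ.finite_range_label hflc hr0).to_subtype
  have := κ.finite_positions hflc r
  have : CompactSpace (κ.subgroupoid haper).carrier :=
    isCompact_iff_compactSpace.1 (κ.isCompact_subgroupoid haper hflc)
  let e := (Finite.equivFin (range (κ.label r))).symm
  let q := fun i => (e i).1
  let p := fun i => (Finite.equivFin (κ.positions r (q i))).symm
  let A := fun i j => κ.piece r (q i) (p i j).1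
  have hA : ∀ i j i' j' S, S ∈ A i j → S ∈ A i' j' →
      (⟨i, j⟩ : Σ i, Fin (Nat.card (κ.positions r (q i)))) = ⟨i', j'⟩ := by
    intro i j i' j' S h h'
    obtain rfl : i = i' := e.injective (Subtype.ext (h.1.symm.trans h'.1))
    obtain rfl : j = j' := (p i).injective (Subtype.ext (h.2.symm.trans h'.2))
    rfl
  have hcov : ∀ S, ∃ i j, S ∈ A i j := by
    intro S
    obtain ⟨i, hi⟩ := e.surjective ⟨κ.label r S, S, rfl⟩
    have hi' : κ.label r S = q i := (congrArg Subtype.val hi).symm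
    obtain ⟨j, hj⟩ := (p i).surjective ⟨κ.centre S, S, hi', rfl⟩
    exact ⟨i, j, hi', (congrArg Subtype.val hj).symm⟩
  have harrow : ∀ i j k S, S ∈ A i j →
      ∃ g ∈ (κ.subgroupoid haper).carrier, g.fst = S ∧ g.snd ∈ A i k := by
    intro i j k S hS
    obtain ⟨S', hS', hc⟩ := (p i k).2
    obtain ⟨g, hg, rfl, hs⟩ := exists_arrow (haper := haper) hr (hS.1.trans hS'.symm)
    exact ⟨g, hg, rfl, (label_snd_eq hg r).trans hS.1, hs.trans hc⟩
  let V : ∀ i, Fin (Nat.card (κ.positions r (q i))) → Fin (Nat.card (κ.positions r (q i))) →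
      Set (κ.subgroupoid haper).carrier := fun i j k => {g | g.1.fst ∈ A i j ∧ g.1.snd ∈ A i k}
  have hVc : ∀ i j k, IsClopen (V i j k) := fun i j k =>
    ((κ.isClopen_piece r _ _).preimage
      (RPunc.continuous_fst.comp continuous_subtype_val)).inter
    ((κ.isClopen_piece r _ _).preimage (RPunc.continuous_snd.comp continuous_subtype_val))
  have hVg : ∀ i j k, IsGSet (V i j k) := by
    intro i j k
    -- With both positions fixed, the displacement is fixed, and each end then determines the arrow.
    have hvec : ∀ g ∈ V i j k, g.1.vec = (p i j).1 - (p i k).1 := fun g hg => by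
      rw [← hg.1.2, ← hg.2.2, ← (mem_subgroupoid κ haper).1 g.2, add_sub_cancel_left]
    refine ⟨fun g hg h hh e => ?_, fun g hg h hh e => ?_⟩
    · exact Subtype.ext (RPunc.ext_vec (congrArg (fun u => u.1.1.fst) e)
        ((hvec g hg).trans (hvec h hh).symm))
    · exact Subtype.ext (RPunc.ext_vec_snd (congrArg (fun u => u.1.1.fst) e)
        ((hvec g hg).trans (hvec h hh).symm))
  have hunit : ∀ u : units (κ.subgroupoid haper).carrier, u.1.1.snd = u.1.1.fst := fun u =>
    congrArg (fun g => g.1.fst) u.2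
  have hVr : ∀ i j k, rngMap '' V i j k = unitTiling (κ.subgroupoid haper) ⁻¹' A i j := by
    intro i j k
    ext u
    constructor
    · rintro ⟨g, hg, rfl⟩; exact hg.1
    · intro hu
      obtain ⟨g, hg, hf, hs⟩ := harrow i j k _ hu
      exact ⟨⟨g, hg⟩, ⟨by rw [hf]; exact hu, hs⟩,
        Subtype.ext (Subtype.ext (RPunc.ext hf (hf.trans (hunit u).symm)))⟩
  have hVs : ∀ i j k, srcMap '' V i j k = unitTiling (κ.subgroupoid haper) ⁻¹' A i k := by
    intro i j k
    ext u
    constructor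
    · rintro ⟨g, hg, rfl⟩; exact hg.2
    · intro hu
      obtain ⟨g, hg, hf, hs⟩ := harrow i k j _ hu
      refine ⟨inv ⟨g, hg⟩, ⟨hs, ?_⟩,
        Subtype.ext (Subtype.ext (RPunc.ext hf (hf.trans (hunit u).symm)))⟩
      change g.fst ∈ A i k
      rw [hf]; exact hu
  refine ⟨{ n := Nat.card (range (κ.label r))
            N := fun i => Nat.card (κ.positions r (q i))
            N_pos := fun i => ?_
            F := fun i j => unitTiling _ ⁻¹' A i j
            F_clopen := fun i j => (κ.isClopen_piece r _ _).preimage (continuous_unitTiling _)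
            F_disjoint := fun a b hab => Set.disjoint_left.2 fun u hu hu' =>
              hab (hA _ _ _ _ _ hu hu')
            F_cover := ?_
            V := V
            V_spec := fun i j k => ⟨(hVc i j k).isClosed.isCompact, (hVc i j k).isOpen, hVg i j k,
              hVr i j k, hVs i j k⟩
            V_unique := ?_
            V_disjoint := ?_
            V_cover := ?_ }, fun i j => ⟨q i, (p i j).1, ?_⟩⟩
  · obtain ⟨S, hS⟩ := (e i).2
    have : Nonempty (κ.positions r (q i)) := ⟨⟨_, S, hS, rfl⟩⟩
    exact Nat.card_pos
  · refine eq_univ_of_forall fun u => ?_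
    obtain ⟨i, j, h⟩ := hcov (unitTiling _ u)
    exact mem_iUnion.2 ⟨i, mem_iUnion.2 ⟨j, h⟩⟩
  · intro i j k V' _ _ hV' hr' hs'
    -- The prescribed ends force `V'` into `V i j k`. Both have the same range and the range map is
    -- injective on `V i j k`, so nothing is missing.
    have hsub : V' ⊆ V i j k := fun g hg => by
      have h1 : rngMap g ∈ rngMap '' V' := ⟨g, hg, rfl⟩
      have h2 : srcMap g ∈ srcMap '' V' := ⟨g, hg, rfl⟩
      rw [hr'] at h1
      rw [hs'] at h2
      exact ⟨h1, h2⟩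
    refine hsub.antisymm fun g hg => ?_
    have h1 : rngMap g ∈ rngMap '' V' := by rw [hr']; exact hg.1
    obtain ⟨g', hg', he⟩ := h1
    rwa [← (hVg i j k).1 (hsub hg') hg he]
  · rintro ⟨i, j, k⟩ ⟨i', j', k'⟩ hne
    refine Set.disjoint_left.2 fun g hg hg' => hne ?_
    have h1 := hA _ _ _ _ _ hg.1 hg'.1
    have h2 := hA _ _ _ _ _ hg.2 hg'.2
    rw [Sigma.mk.injEq] at h1
    obtain ⟨rfl, h1⟩ := h1
    simp only [heq_eq_eq] at h1
    simp only [Sigma.mk.injEq, heq_eq_eq, true_and] at h2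
    rw [h1, h2]
  · refine eq_univ_of_forall fun g => ?_
    obtain ⟨i, j, h⟩ := hcov g.1.fst
    obtain ⟨i', k, h'⟩ := hcov g.1.snd
    obtain rfl : i = i' := e.injective (Subtype.ext
      (h.1.symm.trans ((label_snd_eq g.2 r).symm.trans h'.1)))
    exact mem_iUnion.2 ⟨i, mem_iUnion.2 ⟨j, mem_iUnion.2 ⟨k, h, h'⟩⟩⟩
  · rintro _ ⟨u, hu, rfl⟩
    exact hu

theorem exists_decomposition_ediam_lt (hflc : T.HasFLC) {δ : ℝ} (hδ : 0 < δ) :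
    ∃ Φ : FundamentalDecomposition (κ.subgroupoid haper).carrier, ∀ i j,
      ediam (unitTiling (κ.subgroupoid haper) '' Φ.F i j) < ENNReal.ofReal δ := by
  obtain ⟨B, hB⟩ := ((κ.finite_range_centre hflc).image norm).bddAbove
  have hB' : ∀ S, ‖κ.centre S‖ ≤ B := fun S => hB ⟨_, ⟨S, rfl⟩, rfl⟩
  have hB0 : 0 ≤ B := (norm_nonneg _).trans (hB' (Classical.arbitrary _))
  have hδ2 : 0 < (δ / 2)⁻¹ := by positivity
  have hρ := κ.radius_nonneg
  -- One radius for two purposes: `(δ / 2)⁻¹ + B` makes the pieces small, and exceeding `B +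
  -- κ.radius` lets the label determine the cell.
  obtain ⟨Φ, hΦ⟩ := κ.exists_decomposition haper hflc (r := (δ / 2)⁻¹ + B + κ.radius + 1)
    (by positivity) fun S => by linarith [hB' S]
  refine ⟨Φ, fun i j => ?_⟩
  obtain ⟨Q, c, h⟩ := hΦ i j
  refine (Metric.ediam_mono h).trans_lt ((ediam_piece_le (η := δ / 2) (by positivity)
    (fun S => by linarith [hB' S]) Q c).trans_lt ?_)
  exact (ENNReal.ofReal_lt_ofReal_iff hδ).2 (half_lt_self hδ)

theorem isElementary (hflc : T.HasFLC) : (κ.subgroupoid haper).IsElementary := by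
  obtain ⟨Φ, -⟩ := κ.exists_decomposition_ediam_lt haper hflc one_pos
  exact ⟨κ.units_subset_subgroupoid haper, κ.isCompact_subgroupoid haper hflc,
    Subgroupoid.isLCHEtale_of_isOpen (RPunc.isLCHEtale haper hflc) _
      (κ.isClopen_subgroupoid haper).isOpen,
    _, isClopen_iUnion_of_finite fun i => Φ.F_clopen i _, Φ, rfl⟩

end CentreMap
end Tiling
end TilingGroupoid

namespace TilingGroupoid

open Metric Set Filter Topology

/-- If finitely many closed sets cover a nonempty open set, one of them has an interior that
meets it. -/
theorem exists_inter_interior_nonempty {X α : Type*} [TopologicalSpace X] {I : Set α}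
    (hI : I.Finite) {f : α → Set X} (hf : ∀ a ∈ I, IsClosed (f a)) {U : Set X} (hU : IsOpen U)
    (hne : U.Nonempty) (hcov : U ⊆ ⋃ a ∈ I, f a) :
    ∃ a ∈ I, (U ∩ interior (f a)).Nonempty := by
  induction I, hI using Set.Finite.induction_on generalizing U with
  | empty => simp [Set.subset_empty_iff, hne.ne_empty] at hcov
  | @insert a I _ _ ih =>
    have ha : IsClosed (f a) := hf a (Set.mem_insert _ _)
    -- Either `f a` contains the open set `U`, or the remaining sets cover the nonempty open set `U
    -- \ f a`.
    rcases (U \ f a).eq_empty_or_nonempty with h | h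
    · refine ⟨a, Set.mem_insert _ _, ?_⟩
      rwa [Set.inter_eq_left.2 (interior_maximal (sdiff_eq_empty.1 h) hU)]
    · obtain ⟨b, hb, z, hz, hz'⟩ := ih (fun b hb => hf b (Set.mem_insert_of_mem _ hb))
        (hU.sdiff ha) h fun x hx => by
          have := hcov hx.1
          rw [Set.biUnion_insert] at this
          exact this.resolve_left hx.2
      exact ⟨b, Set.mem_insert_of_mem _ hb, z, hz.1, hz'⟩

section Tiling

variable {d : ℕ} {ι : Type*} [Finite ι] {P : PrototileSet d ι} {T : Tiling P}

/-! ### Occurrences of a patch -/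

/-- The positions at which translates of `Q` occur in `S`. -/
def Tiling.occurrences (S : Tiling P) (Q : Set (Tile d ι)) : Set (EuclideanSpace ℝ (Fin d)) :=
  {p | translateTiles Q p ⊆ S.tiles}

theorem Tiling.mem_occurrences_translate {S : Tiling P} {Q : Set (Tile d ι)}
    {p x : EuclideanSpace ℝ (Fin d)} :
    p ∈ (S.translate x).occurrences Q ↔ p - x ∈ S.occurrences Q := by
  constructor
  · intro h
    have h1 := translateTiles_mono h (-x)
    have h2 : translateTiles (S.translate x).tiles (-x) = S.tiles := by
      change ((S.translate x).translate (-x)).tiles = _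
      rw [Tiling.translate_translate, add_neg_cancel, Tiling.translate_zero]
    rwa [h2, translateTiles_translateTiles, ← sub_eq_add_neg] at h1
  · intro h
    have h1 := translateTiles_mono h x
    rwa [translateTiles_translateTiles, sub_add_cancel] at h1

/-- A tiling that contains the tiles of `S` meeting a ball has no other tiles with a puncture in
this ball. -/
theorem Tiling.mem_tiles_iff_of_ballPatch_subset {S S' : Tiling P} {r : ℝ}
    (h : S.ballPatch 0 r ⊆ S'.tiles) {t : Tile d ι} (ht : ‖P.punct t‖ < r) :
    t ∈ S.tiles ↔ t ∈ S'.tiles := by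
  refine ⟨fun hS => h (Tiling.mem_ballPatch_of_norm_punct hS (by simpa using ht)), fun hS' => ?_⟩
  set U := interior (P.support t) ∩ ball 0 r with hU
  have hUo : IsOpen U := isOpen_interior.inter isOpen_ball
  have hUn : U.Nonempty := ⟨P.punct t, punct_mem_interior P t, by simpa using ht⟩
  have hfin := S.finite_ballPatch 0 r
  -- Finitely many closed tiles of `S` cover the open set `U`, so the interior of one of them meets
  -- it. That tile and `t` both belong to `S'`, hence coincide. Density of the interior in a tile is
  -- not needed.
  have : ∃ t' ∈ S.ballPatch 0 r, (U ∩ interior (P.support t')).Nonempty := by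
    refine exists_inter_interior_nonempty hfin
      (fun t' _ => (isCompact_support P t').isClosed) hUo hUn fun y hy => ?_
    exact S.ball_subset_ballPatch 0 r hy.2
  obtain ⟨t', ht', z, hz, hz'⟩ := this
  have htt : t = t' := by
    by_contra hne
    exact Set.disjoint_left.1 (S'.disjoint t hS' t' (h ht') hne) hz.1 hz'
  rw [htt]
  exact ht'.1

/-- Occurrences of a large patch of a nonperiodic tiling have no given nonzero difference. -/
theorem Tiling.exists_radius_of_ne (S : Tiling P) (hS : S.IsNonperiodic)
    {v : EuclideanSpace ℝ (Fin d)} (hv : v ≠ 0) : ∃ ρ : ℝ, ∀ r, ρ ≤ r → ∀ S' : Tiling P,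
      0 ∈ S'.occurrences (S.ballPatch 0 r) → v ∉ S'.occurrences (S.ballPatch 0 r) := by
  have hne : ¬ ∀ t : Tile d ι, t ∈ S.tiles ↔ (t.1, t.2 + v) ∈ S.tiles := by
    intro h
    refine hv (hS v (Tiling.ext (Set.ext fun t => ?_)))
    constructor
    · rintro ⟨t, ht, rfl⟩
      exact (h t).1 ht
    · intro ht
      exact ⟨(t.1, t.2 - v), (h _).2 (by simpa using ht), by simp⟩
  push Not at hne
  obtain ⟨t, ht⟩ := hne
  -- Exactly one of `t` and `t + v` belongs to `S`, and a patch of this radius decides both.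
  -- Occurrences at `0` and at `v` would identify the two memberships through `S'`.
  refine ⟨‖P.punct t‖ + ‖v‖ + 1, fun r hr S' h0 hv' => ?_⟩
  have h1 : S.ballPatch 0 r ⊆ S'.tiles := by
    have : translateTiles (S.ballPatch 0 r) 0 ⊆ S'.tiles := h0
    rwa [translateTiles_zero] at this
  have h2 : S.ballPatch 0 r ⊆ (S'.translate (-v)).tiles := by
    have : translateTiles (S.ballPatch 0 r) 0 ⊆ (S'.translate (-v)).tiles :=
      Tiling.mem_occurrences_translate.2 (by simpa using hv')
    rwa [translateTiles_zero] at this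
  have h3 : (t.1, t.2 + v) ∈ S'.tiles ↔ t ∈ (S'.translate (-v)).tiles := by
    constructor
    · exact fun h => ⟨_, h, by simp⟩
    · rintro ⟨t', ht', rfl⟩
      simpa using ht'
  have h4 : ‖P.punct (t.1, t.2 + v)‖ < r := by
    rw [punct_translate]
    linarith [norm_add_le (P.punct t) v]
  have h5 : ‖P.punct t‖ < r := by linarith [norm_nonneg v]
  have e : t ∈ S.tiles ↔ (t.1, t.2 + v) ∈ S.tiles :=
    (Tiling.mem_tiles_iff_of_ballPatch_subset h2 h5).trans
      (h3.symm.trans (Tiling.mem_tiles_iff_of_ballPatch_subset h1 h4).symm)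
  rcases ht with ⟨h, h'⟩ | ⟨h, h'⟩
  · exact h' (e.1 h)
  · exact h (e.2 h')

/-- Occurrences of a large patch of a nonperiodic tiling are sparse. -/
theorem Tiling.exists_pairwiseSep_occurrences (S : Tiling P) (hS : S.IsNonperiodic)
    (h0 : 0 ∈ S.puncts) (R : ℝ) : ∃ r : ℝ, 0 < r ∧ ∀ S' : Tiling P,
      PairwiseSep R (S'.occurrences (S.ballPatch 0 r)) := by
  have hfin : (S.puncts ∩ ball 0 R).Finite :=
    (S.pairwiseSep_puncts.mono inter_subset_left).finite_of_isBounded P.inr_pos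
      (isBounded_ball.subset inter_subset_right)
  have hρ : ∀ v : EuclideanSpace ℝ (Fin d), ∃ ρ : ℝ, v ≠ 0 → ∀ r, ρ ≤ r → ∀ S' : Tiling P,
      0 ∈ S'.occurrences (S.ballPatch 0 r) → v ∉ S'.occurrences (S.ballPatch 0 r) := by
    intro v
    by_cases hv : v = 0
    · exact ⟨0, fun h => absurd hv h⟩
    · obtain ⟨ρ, h⟩ := S.exists_radius_of_ne hS hv
      exact ⟨ρ, fun _ => h⟩
  choose ρ hρ using hρ
  obtain ⟨B, hB⟩ := (hfin.image ρ).bddAbove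
  refine ⟨max B (max R 1), by positivity, fun S' x hx y hy hxy => ?_⟩
  by_contra hne
  have hx0 : 0 ∈ (S'.translate (-x)).occurrences (S.ballPatch 0 (max B (max R 1))) :=
    Tiling.mem_occurrences_translate.2 (by simpa using hx)
  have hyx : y - x ∈ (S'.translate (-x)).occurrences (S.ballPatch 0 (max B (max R 1))) :=
    Tiling.mem_occurrences_translate.2 (by simpa using hy)
  have hnorm : ‖y - x‖ < R := by rwa [norm_sub_rev]
  refine hρ (y - x) (sub_ne_zero.2 (Ne.symm hne)) _ ?_ _ hx0 hyx
  refine (hB ⟨y - x, ⟨?_, by simpa using hnorm⟩, rfl⟩).trans (le_max_left _ _)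
  -- The difference `y - x` is a puncture of `S`: the second occurrence contains the tile at the
  -- origin moved by `y - x`, and the first occurrence, of radius at least `R`, still sees it. So
  -- finitely many differences need to be excluded.
  obtain ⟨t, ht, ht0⟩ := h0
  have hQ : S.ballPatch 0 (max B (max R 1)) ⊆ (S'.translate (-x)).tiles := by
    have : translateTiles (S.ballPatch 0 (max B (max R 1))) 0 ⊆ (S'.translate (-x)).tiles := hx0
    rwa [translateTiles_zero] at this
  have hp : P.punct (t.1, t.2 + (y - x)) = y - x := by rw [punct_translate, ht0, zero_add]
  refine ⟨(t.1, t.2 + (y - x)), ?_, hp⟩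
  refine (Tiling.mem_tiles_iff_of_ballPatch_subset hQ ?_).2 (hyx ⟨t, ?_, rfl⟩)
  · rw [hp]
    exact hnorm.trans_le ((le_max_left _ _).trans (le_max_right _ _))
  · refine Tiling.mem_ballPatch_of_norm_punct ht ?_
    rw [ht0, sub_zero, norm_zero]
    positivity

/-- In a repetitive tiling and the tilings in its hull, occurrences of patches are relatively
dense. -/
theorem exists_occurrence_near (hrep : T.IsRepetitive) (x₀ : EuclideanSpace ℝ (Fin d)) {r : ℝ}
    (hr : 0 < r) (h0 : 0 ∈ (T.translate x₀).puncts) : ∃ R : ℝ, ∀ S ∈ T.hull, ∀ x,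
      ∃ p ∈ S.occurrences ((T.translate x₀).ballPatch 0 r), ‖p - x‖ ≤ R := by
  obtain ⟨R, hR, hQ⟩ := hrep _ (T.isPatch_ballPatch (-x₀) hr)
  refine ⟨R + P.outr, fun S hS x => ?_⟩
  -- This radius makes the region of agreement contain the ball of radius `R` about `x`, where
  -- repetitivity of `T` supplies the occurrence.
  obtain ⟨w, hw⟩ := Tiling.mem_hull_iff.1 hS (‖x‖ + R) (by positivity)
  obtain ⟨y, hy⟩ := hQ (x - w)
  have e : (T.translate x₀).ballPatch 0 r = translateTiles (T.ballPatch (-x₀) r) x₀ := by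
    rw [← Tiling.ballPatch_translate, neg_add_cancel]
  have hsub : translateTiles ((T.translate x₀).ballPatch 0 r) (-x₀ + (y + w)) ⊆
      S.ballPatch x R := by
    rw [e, translateTiles_translateTiles, add_neg_cancel_left, ← translateTiles_translateTiles]
    refine (translateTiles_mono hy w).trans ?_
    rw [← Tiling.ballPatch_translate, sub_add_cancel]
    intro t ht
    refine ⟨hw.symm.mem_tiles ht.1 (ht.2.mono (inter_subset_inter_right _ ?_)), ht.2⟩
    exact ball_subset_ball' (by rw [dist_zero_right, add_comm])
  refine ⟨-x₀ + (y + w), fun t ht => (hsub ht).1, ?_⟩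
  obtain ⟨t, ht, ht0⟩ := h0
  have hmem : t ∈ (T.translate x₀).ballPatch 0 r :=
    Tiling.mem_ballPatch_of_norm_punct ht (by rw [ht0]; simpa using hr)
  have := Tiling.norm_punct_of_mem_ballPatch (hsub ⟨t, hmem, rfl⟩)
  rw [punct_translate, ht0, zero_add] at this
  exact this.le

/-! ### Nearest points -/

/-- The points of `D` nearest to the origin. -/
def nearest {E : Type*} [NormedAddCommGroup E] (D : Set E) : Set E :=
  {p | p ∈ D ∧ ∀ q ∈ D, ‖p‖ ≤ ‖q‖}

theorem nearest_nonempty {E : Type*} [NormedAddCommGroup E] [ProperSpace E] {s : ℝ} (hs : 0 < s)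
    {D : Set E} (hD : PairwiseSep s D) (hne : D.Nonempty) : (nearest D).Nonempty := by
  obtain ⟨x, hx⟩ := hne
  have hfin : (D ∩ closedBall 0 ‖x‖).Finite := (hD.mono inter_subset_left).finite_of_isBounded hs
    (isBounded_closedBall.subset inter_subset_right)
  obtain ⟨p, hp, hmin⟩ := Set.exists_min_image _ norm hfin ⟨x, hx, by simp⟩
  refine ⟨p, hp.1, fun q hq => ?_⟩
  rcases le_or_gt ‖q‖ ‖x‖ with h | h
  · exact hmin q ⟨hq, by simpa using h⟩
  · have := hp.2
    rw [mem_closedBall, dist_zero_right] at this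
    exact this.trans h.le

/-- A closed ball that contains a point of `D` also contains all its nearest points; this makes the
choice of a centre locally determined. -/
theorem nearest_subset_of_inter_closedBall {E : Type*} [NormedAddCommGroup E] {D D' : Set E} {R : ℝ}
    (h : ∀ x, ‖x‖ ≤ R → (x ∈ D ↔ x ∈ D')) (hD : ∃ x ∈ D, ‖x‖ ≤ R) : nearest D ⊆ nearest D' := by
  obtain ⟨x, hx, hxR⟩ := hD
  intro p hp
  have hpR := (hp.2 x hx).trans hxR
  refine ⟨(h p hpR).1 hp.1, fun q hq => ?_⟩
  rcases le_or_gt ‖q‖ R with hqR | hqR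
  · exact hp.2 q ((h q hqR).2 hq)
  · exact hpR.trans hqR.le

/-- There are centre maps for which the centres are arbitrarily sparse and the cells are
Voronoi cells. -/
theorem exists_centreMap (haper : T.IsAperiodic) (hrep : T.IsRepetitive) {R : ℝ} (hR : 0 < R) :
    ∃ (κ : CentreMap T) (D : DiscreteHull T → Set (EuclideanSpace ℝ (Fin d))) (R₁ : ℝ),
      ∀ S : DiscreteHull T, PairwiseSep R (D S) ∧ (∀ x, ∃ p ∈ D S, ‖p - x‖ ≤ R₁) ∧
        ∀ p (hp : p ∈ S.1.puncts), κ.centre (S.shift p hp) + p ∈ D S ∧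
          ∀ q ∈ D S, ‖κ.centre (S.shift p hp) + p - p‖ ≤ ‖q - p‖ := by
  obtain ⟨p₀, hp₀, -⟩ := T.exists_punct_near 0
  have h0 : 0 ∈ (T.translate (-p₀)).puncts :=
    Tiling.mem_puncts_translate.2 (by simpa using hp₀)
  obtain ⟨r, hr, hsep⟩ := (T.translate (-p₀)).exists_pairwiseSep_occurrences
    (haper _ (Tiling.translate_mem_hull T.self_mem_hull _)) h0 R
  obtain ⟨R₁, hR₁⟩ := exists_occurrence_near hrep (-p₀) hr h0
  set Q := (T.translate (-p₀)).ballPatch 0 r with hQ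
  have hloc : ∀ S S' : DiscreteHull T, AgreeOn (|R₁| + r) S.1 S'.1 → ∀ x, ‖x‖ ≤ |R₁| →
      x ∈ S.1.occurrences Q → x ∈ S'.1.occurrences Q := by
    rintro S S' h x hx hxS _ ⟨t, ht, rfl⟩
    refine h.mem_tiles (hxS ⟨t, ht, rfl⟩) ?_
    obtain ⟨z, hz, hzr⟩ := ht.2
    refine ⟨z + x, ?_, ?_⟩
    · rw [support_add]; exact ⟨z, hz, rfl⟩
    · rw [mem_ball_zero_iff] at hzr ⊢
      linarith [norm_add_le z x]
  have hnear : ∀ S : DiscreteHull T, ∃ x ∈ S.1.occurrences Q, ‖x‖ ≤ |R₁| := fun S => by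
    obtain ⟨p, hp, h⟩ := hR₁ S.1 S.2.1 0
    exact ⟨p, hp, by rw [sub_zero] at h; exact h.trans (le_abs_self _)⟩
  -- `Classical.epsilon` breaks ties as a function of the set of nearest points alone, so tilings
  -- with the same nearest occurrences receive the same centre.
  have hspec : ∀ S : DiscreteHull T,
      Classical.epsilon (· ∈ nearest (S.1.occurrences Q)) ∈ nearest (S.1.occurrences Q) := by
    intro S
    obtain ⟨x, hx, -⟩ := hnear S
    exact Classical.epsilon_spec (nearest_nonempty hR (hsep S.1) ⟨x, hx⟩)
  refine ⟨{ centre := fun S => Classical.epsilon (· ∈ nearest (S.1.occurrences Q))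
            centre_mem := fun S => ?_
            radius := |R₁| + r
            radius_nonneg := by positivity
            centre_eq := fun S S' h => ?_ }, fun S => S.1.occurrences Q, R₁, fun S =>
    ⟨hsep S.1, hR₁ S.1 S.2.1, fun p hp => ?_⟩⟩
  · obtain ⟨t, ht, ht0⟩ := h0
    refine ⟨_, (hspec S).1 ⟨t, Tiling.mem_ballPatch_of_norm_punct ht ?_, rfl⟩, ?_⟩
    · rw [ht0]; simpa using hr
    · rw [punct_translate, ht0, zero_add]
  · have e : nearest (S.1.occurrences Q) = nearest (S'.1.occurrences Q) :=
      Set.Subset.antisymm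
        (nearest_subset_of_inter_closedBall
          (fun x hx => ⟨hloc S S' h x hx, hloc S' S h.symm x hx⟩) (hnear S))
        (nearest_subset_of_inter_closedBall
          (fun x hx => ⟨hloc S' S h.symm x hx, hloc S S' h x hx⟩) (hnear S'))
    simp only [e]
  · obtain ⟨h1, h2⟩ := hspec (S.shift p hp)
    -- Translation equivariance turns "nearest to the origin in `S - p`" into "nearest to `p` in
    -- `S`".
    have key : ∀ q, q ∈ (S.shift p hp).1.occurrences Q ↔ q + p ∈ S.1.occurrences Q := fun q => by
      change q ∈ (S.1.translate (-p)).occurrences Q ↔ _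
      rw [Tiling.mem_occurrences_translate, sub_neg_eq_add]
    refine ⟨(key _).1 h1, fun q hq => ?_⟩
    rw [add_sub_cancel_right]
    exact h2 _ ((key _).2 (by rwa [sub_add_cancel]))

end Tiling
end TilingGroupoid

namespace TilingGroupoid

open Metric Set Filter Topology MeasureTheory
open scoped Pointwise RealInnerProductSpace

/-! ### Voronoi cells -/

section Voronoi

variable {E : Type*} [NormedAddCommGroup E] [InnerProductSpace ℝ E]

/-- The Voronoi cell of `c` with respect to `D`, dilated by the factor `t` about `c`. -/
def voronoi (D : Set E) (c : E) (t : ℝ) : Set E :=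
  {z | ∀ w ∈ D, 2 * ⟪z - c, w - c⟫ ≤ t * ‖w - c‖ ^ 2}

/-- Comparison of distances to `c` and `w` becomes an affine inequality in `z`, which can be
dilated. -/
theorem norm_sub_sq_sub_norm_sub_sq (z c w : E) :
    ‖w - z‖ ^ 2 - ‖c - z‖ ^ 2 = ‖w - c‖ ^ 2 - 2 * ⟪z - c, w - c⟫ := by
  have e : w - z = (w - c) - (z - c) := by abel
  rw [e, norm_sub_sq_real, norm_sub_rev c z, real_inner_comm]
  ring

theorem two_inner_le_iff {z c w : E} :
    2 * ⟪z - c, w - c⟫ ≤ ‖w - c‖ ^ 2 ↔ ‖c - z‖ ≤ ‖w - z‖ := by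
  rw [← sub_nonneg, ← norm_sub_sq_sub_norm_sub_sq, sub_nonneg,
    sq_le_sq₀ (norm_nonneg _) (norm_nonneg _)]

theorem le_two_inner_iff {z c w : E} :
    ‖w - c‖ ^ 2 ≤ 2 * ⟪z - c, w - c⟫ ↔ ‖w - z‖ ≤ ‖c - z‖ := by
  rw [← sub_nonpos, ← norm_sub_sq_sub_norm_sub_sq, sub_nonpos,
    sq_le_sq₀ (norm_nonneg _) (norm_nonneg _)]

/-- The error is linear in `‖w - c‖`, while dilating the half-space gains a multiple of `‖w - c‖ ^
2`; sparseness of `D` lets the gain win. -/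
theorem two_inner_le_add {x y c w : E} {a : ℝ} (h : ‖x - y‖ ≤ a) :
    2 * ⟪x - c, w - c⟫ ≤ 2 * ⟪y - c, w - c⟫ + 2 * a * ‖w - c‖ := by
  have e : x - c = (y - c) + (x - y) := by abel
  rw [e, inner_add_left]
  have h1 := real_inner_le_norm (x - y) (w - c)
  have h2 := mul_le_mul_of_nonneg_right h (norm_nonneg (w - c))
  linarith

theorem isClosed_voronoi (D : Set E) (c : E) (t : ℝ) : IsClosed (voronoi D c t) := by
  simp only [voronoi, ofPred_forall]
  exact isClosed_biInter fun w _ => isClosed_le (by fun_prop) continuous_const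

/-- The defining inequalities are homogeneous in `(z - c, t)`. Volumes of cells therefore scale by a
power of `t`. -/
theorem voronoi_eq_preimage (D : Set E) (c : E) {t : ℝ} (ht : 0 < t) :
    voronoi D c t = (fun z => z - c) ⁻¹' (t • ((fun z => z + c) ⁻¹' voronoi D c 1)) := by
  ext z
  simp only [mem_preimage, Set.mem_smul_set_iff_inv_smul_mem₀ ht.ne', voronoi, mem_ofPred_eq,
    add_sub_cancel_right, inner_smul_left]
  refine forall₂_congr fun w _ => ?_
  simp only [conj_trivial, one_mul]
  rw [mul_left_comm, inv_mul_le_iff₀ ht]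

theorem voronoi_mono (D : Set E) (c : E) {t t' : ℝ} (h : t ≤ t') :
    voronoi D c t ⊆ voronoi D c t' := fun z hz w hw =>
  (hz w hw).trans (mul_le_mul_of_nonneg_right h (by positivity))

theorem voronoi_one_subset {D : Set E} {R : ℝ} (hD : ∀ x, ∃ p ∈ D, ‖p - x‖ ≤ R) (c : E) :
    voronoi D c 1 ⊆ closedBall c R := fun z hz => by
  obtain ⟨p, hp, hpz⟩ := hD z
  rw [mem_closedBall, dist_eq_norm, norm_sub_rev]
  exact (two_inner_le_iff.1 (by simpa using hz p hp)).trans hpz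

variable [FiniteDimensional ℝ E] [MeasurableSpace E] [BorelSpace E]

theorem volume_real_voronoi (D : Set E) (c : E) {t : ℝ} (ht : 0 < t) :
    volume.real (voronoi D c t) = t ^ Module.finrank ℝ E * volume.real (voronoi D c 1) := by
  have h1 : volume (voronoi D c t) =
      ENNReal.ofReal (t ^ Module.finrank ℝ E) * volume (voronoi D c 1) := by
    rw [voronoi_eq_preimage D c ht]
    simp only [sub_eq_add_neg]
    rw [measure_preimage_add_right, Measure.addHaar_smul, measure_preimage_add_right,
      abs_of_pos (by positivity)]
  rw [measureReal_def, h1, ENNReal.toReal_mul, ENNReal.toReal_ofReal (by positivity)]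
  rfl

/-! ### Packing and covering -/

theorem ncard_mul_volume_ball_le {s : ℝ} {A U : Set E} (hA : A.Finite)
    (hsep : PairwiseSep s A) (hU : volume U ≠ ⊤) (hAU : ∀ q ∈ A, ball q (s / 2) ⊆ U) :
    A.ncard * volume.real (ball (0 : E) (s / 2)) ≤ volume.real U := by
  lift A to Finset E using hA
  have hdisj : (A : Set E).PairwiseDisjoint fun q => ball q (s / 2) := by
    intro x hx y hy hne
    refine Set.disjoint_left.2 fun z hz hz' => hne (hsep x hx y hy ?_)
    rw [mem_ball, dist_eq_norm] at hz hz'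
    rw [norm_sub_rev] at hz
    linarith [norm_sub_le_norm_sub_add_norm_sub x z y]
  have h := measureReal_biUnion_finset (μ := (volume : Measure E)) hdisj
    (fun q _ => measurableSet_ball) (h := fun q _ => measure_ball_lt_top.ne)
  have h2 : volume.real (⋃ q ∈ A, ball q (s / 2)) ≤ volume.real U :=
    measureReal_mono (iUnion₂_subset hAU) hU
  rw [h] at h2
  simpa [measureReal_def, Measure.addHaar_ball_center] using h2

theorem volume_le_ncard_mul {M : ℝ} {A U : Set E} (hA : A.Finite)
    (hAU : ∀ z ∈ U, ∃ p ∈ A, ‖z - p‖ ≤ M) :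
    volume.real U ≤ A.ncard * volume.real (closedBall (0 : E) M) := by
  lift A to Finset E using hA
  have hsub : U ⊆ ⋃ q ∈ A, closedBall q M := fun z hz => by
    obtain ⟨p, hp, h⟩ := hAU z hz
    exact mem_iUnion₂.2 ⟨p, hp, by rwa [mem_closedBall, dist_eq_norm]⟩
  have h1 : volume.real U ≤ volume.real (⋃ q ∈ A, closedBall q M) :=
    measureReal_mono hsub
      ((A.finite_toSet.isCompact_biUnion fun q _ => isCompact_closedBall q M).measure_ne_top)
  have h2 := measureReal_biUnion_finset_le (μ := (volume : Measure E)) A fun q => closedBall q M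
  refine (h1.trans h2).trans_eq ?_
  simp [measureReal_def, Measure.addHaar_closedBall_center]

/-- At `η = 0` the inequality reads `0 < ε * v`; it persists for small `η` by continuity. -/
theorem exists_dilation_factor (n : ℕ) {v V ε : ℝ} (hv : 0 < v) (hε : 0 < ε) :
    ∃ η : ℝ, 0 < η ∧ η < 1 ∧ ((1 + η) ^ n - (1 - η) ^ n) * V < ε * v * (1 - η) ^ n := by
  have hc : Continuous fun η : ℝ => ε * v * (1 - η) ^ n - ((1 + η) ^ n - (1 - η) ^ n) * V := by
    fun_prop
  have h0 : ∀ᶠ η in 𝓝[>] (0 : ℝ), 0 < ε * v * (1 - η) ^ n - ((1 + η) ^ n - (1 - η) ^ n) * V := by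
    refine nhdsWithin_le_nhds (hc.continuousAt.eventually (lt_mem_nhds ?_))
    simp only [sub_zero, add_zero, one_pow, mul_one, sub_self, zero_mul]
    positivity
  obtain ⟨η, h1, h2⟩ := (h0.and (Ioo_mem_nhdsGT (one_pos : (0 : ℝ) < 1))).exists
  exact ⟨η, h2.1, h2.2, by linarith⟩

/-! ### The boundary estimate. -/

/-- If `f` maps the points of a Delone set `A` to nearest points of a sparse enough Delone set
`D`, then few points of `A` lie outside a fibre of `f` but near to it. -/
theorem exists_sep_boundary_lt {s M ρ ε : ℝ} (hs : 0 < s) (hM : 0 ≤ M) (hρ : 0 ≤ ρ)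
    (hε : 0 < ε) : ∃ R : ℝ, 0 < R ∧ ∀ (A D : Set E) (f : E → E) (R₁ : ℝ), PairwiseSep s A →
      (∀ x, ∃ p ∈ A, ‖x - p‖ ≤ M) → PairwiseSep R D → (∀ x, ∃ p ∈ D, ‖p - x‖ ≤ R₁) →
      (∀ p ∈ A, f p ∈ D ∧ ∀ q ∈ D, ‖f p - p‖ ≤ ‖q - p‖) → ∀ c ∈ D,
      {p ∈ A | f p = c}.Finite ∧ {p ∈ A | f p = c}.Nonempty ∧
      {q ∈ A | f q ≠ c ∧ ∃ p ∈ A, f p = c ∧ ‖q - p‖ ≤ ρ}.Finite ∧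
      ({q ∈ A | f q ≠ c ∧ ∃ p ∈ A, f p = c ∧ ‖q - p‖ ≤ ρ}.ncard : ℝ) <
        ε * {p ∈ A | f p = c}.ncard := by
  have hv : 0 < volume.real (ball (0 : E) (s / 2)) :=
    ENNReal.toReal_pos (measure_ball_pos _ _ (by linarith)).ne' measure_ball_lt_top.ne
  obtain ⟨η, hη0, hη1, hη⟩ := exists_dilation_factor (Module.finrank ℝ E)
    (V := volume.real (closedBall (0 : E) M)) hv hε
  -- The numerator dominates the three displacement errors `2 * M`, `2 * ρ + s` and `s` met below;
  -- the `1` makes this strict.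
  refine ⟨(2 * ρ + s + 2 * M + 1) / η, by positivity, ?_⟩
  intro A D f R₁ hA hAM hD hDR hf c hc
  have hdist : ∀ w ∈ D, w ≠ c → 2 * ρ + s + 2 * M + 1 ≤ η * ‖w - c‖ := by
    intro w hw hne
    have : (2 * ρ + s + 2 * M + 1) / η ≤ ‖w - c‖ := by
      by_contra! h
      exact hne (hD w hw c hc h)
    rwa [div_le_iff₀ hη0, mul_comm ‖w - c‖] at this
  have hpos : ∀ w : E, w ≠ c → 0 < ‖w - c‖ := fun w hw => norm_pos_iff.2 (sub_ne_zero.2 hw)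
  set cell := {p ∈ A | f p = c} with hcell
  set bd := {q ∈ A | f q ≠ c ∧ ∃ p ∈ A, f p = c ∧ ‖q - p‖ ≤ ρ} with hbd
  have hcellW : cell ⊆ closedBall c R₁ := by
    refine Set.Subset.trans (b := voronoi D c 1) (fun p hp w hw => ?_) (voronoi_one_subset hDR c)
    rw [one_mul, two_inner_le_iff, ← hp.2]
    exact (hf p hp.1).2 w hw
  have hcellfin : cell.Finite :=
    (hA.mono fun p hp => hp.1).finite_of_isBounded hs (isBounded_closedBall.subset hcellW)
  have hbdfin : bd.Finite := by
    refine (hA.mono fun p hp => hp.1).finite_of_isBounded hs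
      ((isBounded_closedBall (x := c) (r := ρ + R₁)).subset ?_)
    rintro q ⟨-, -, p, hp, hpc, hqp⟩
    have := hcellW ⟨hp, hpc⟩
    rw [mem_closedBall, dist_eq_norm] at this ⊢
    linarith [norm_sub_le_norm_sub_add_norm_sub q p c]
  -- A point of `A` within `M` of the shrunken Voronoi cell cannot be nearest to another `w`: this
  -- would give `η * ‖w - c‖ ≤ 2 * M`.
  have hinner : ∀ z ∈ voronoi D c (1 - η), ∃ p ∈ cell, ‖z - p‖ ≤ M := by
    intro z hz
    obtain ⟨p, hp, hzp⟩ := hAM z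
    refine ⟨p, ⟨hp, ?_⟩, hzp⟩
    by_contra hne
    have h1 := le_two_inner_iff.2 ((hf p hp).2 c hc)
    have h2 := two_inner_le_add (c := c) (w := f p) ((norm_sub_rev p z).trans_le hzp)
    have h3 := hz _ (hf p hp).1
    have h4 := mul_le_mul_of_nonneg_right (hdist _ (hf p hp).1 hne) (norm_nonneg (f p - c))
    nlinarith [hpos _ hne]
  have hcellne : cell.Nonempty := by
    obtain ⟨p, hp, -⟩ := hinner c fun w _ => by
      rw [sub_self, inner_zero_left, mul_zero]
      exact mul_nonneg (by linarith) (by positivity)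
    exact ⟨p, hp⟩
  refine ⟨hcellfin, hcellne, hbdfin, ?_⟩
  have hfin : volume (voronoi D c (1 + η)) ≠ ⊤ := by
    have h1 : volume ((fun z => z + c) ⁻¹' voronoi D c 1) ≠ ⊤ := by
      rw [measure_preimage_add_right]
      exact (measure_mono (voronoi_one_subset hDR c)).trans_lt measure_closedBall_lt_top |>.ne
    rw [voronoi_eq_preimage D c (by linarith)]
    simp only [sub_eq_add_neg]
    rw [measure_preimage_add_right, Measure.addHaar_smul]
    exact ENNReal.mul_ne_top ENNReal.ofReal_ne_top h1
  -- The balls about boundary points lie in the shell: they are within `ρ + s / 2` of a point of the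
  -- cell, and within `s / 2` of a point assigned to another centre.
  have hpack := ncard_mul_volume_ball_le (U := voronoi D c (1 + η) \ voronoi D c (1 - η)) hbdfin
    (hA.mono fun p hp => hp.1) (measure_ne_top_of_subset sdiff_subset hfin) (by
      rintro q ⟨hq, hqc, p, hp, hpc, hqp⟩ z hz
      rw [mem_ball, dist_eq_norm] at hz
      refine ⟨fun w hw => ?_, fun hzW => ?_⟩
      · rcases eq_or_ne w c with rfl | hne
        · simp
        · have h1 : 2 * ⟪p - c, w - c⟫ ≤ ‖w - c‖ ^ 2 :=
            two_inner_le_iff.2 (hpc ▸ (hf p hp).2 w hw)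
          have h2 := two_inner_le_add (x := z) (y := p) (c := c) (w := w) (a := ρ + s / 2)
            (by linarith [norm_sub_le_norm_sub_add_norm_sub z q p])
          have h4 := mul_le_mul_of_nonneg_right (hdist _ hw hne) (norm_nonneg (w - c))
          nlinarith [hpos _ hne]
      · have h1 := le_two_inner_iff.2 ((hf q hq).2 c hc)
        have h2 := two_inner_le_add (c := c) (w := f q) ((norm_sub_rev q z).trans_le hz.le)
        have h3 := hzW _ (hf q hq).1
        have h4 := mul_le_mul_of_nonneg_right (hdist _ (hf q hq).1 hqc) (norm_nonneg (f q - c))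
        nlinarith [hpos _ hqc])
  rw [measureReal_sdiff (voronoi_mono D c (by linarith)) (isClosed_voronoi D c _).measurableSet
    (measure_ne_top_of_subset (voronoi_mono D c (by linarith)) hfin),
    volume_real_voronoi D c (t := 1 + η) (by linarith),
    volume_real_voronoi D c (t := 1 - η) (by linarith),
    ← sub_mul] at hpack
  have hcov := volume_le_ncard_mul hcellfin hinner
  rw [volume_real_voronoi D c (t := 1 - η) (by linarith)] at hcov
  have hn : (0 : ℝ) < cell.ncard := by
    exact_mod_cast (Set.ncard_pos hcellfin).2 hcellne
  have ha : 0 ≤ (1 + η) ^ Module.finrank ℝ E - (1 - η) ^ Module.finrank ℝ E :=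
    sub_nonneg.2 (pow_le_pow_left₀ (by linarith) (by linarith) _)
  have hb : 0 < (1 - η) ^ Module.finrank ℝ E := pow_pos (by linarith) _
  generalize (1 + η) ^ Module.finrank ℝ E - (1 - η) ^ Module.finrank ℝ E = a at *
  generalize (1 - η) ^ Module.finrank ℝ E = b at *
  generalize volume.real (closedBall (0 : E) M) = V at *
  generalize volume.real (ball (0 : E) (s / 2)) = v at *
  generalize volume.real (voronoi D c 1) = m at *
  -- The volume `m` of the Voronoi cell is eliminated between the packing bound for `bd` and the
  -- covering bound for `cell`; the choice of `η` finishes.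
  refine lt_of_mul_lt_mul_right (a := v * b) ?_ (by positivity)
  calc (bd.ncard : ℝ) * (v * b) = (bd.ncard * v) * b := by ring
    _ ≤ (a * m) * b := mul_le_mul_of_nonneg_right hpack hb.le
    _ = a * (b * m) := by ring
    _ ≤ a * (cell.ncard * V) := mul_le_mul_of_nonneg_left hcov ha
    _ = (a * V) * cell.ncard := by ring
    _ < (ε * v * b) * cell.ncard := mul_lt_mul_of_pos_right hη hn
    _ = ε * cell.ncard * (v * b) := by ring

end Voronoi
end TilingGroupoid

namespace TilingGroupoid

open Metric Set Filter Topology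

open ArrowGroupoid

section Tiling

variable {d : ℕ} {ι : Type*} [Finite ι] {P : PrototileSet d ι} {T : Tiling P}

/-! ### Invariance -/

/-- The puncture `-g.vec` of the source marks the origin of the range, so arrows into a fibre are
counted as punctures of `S`. -/
theorem RPunc.injOn_neg_vec (S : DiscreteHull T) :
    InjOn (fun g : RPunc T => -g.vec) {g | g.snd = S} := fun _ hg _ hh e =>
  RPunc.ext_vec_snd (Eq.trans hg (Eq.symm hh)) (neg_injective e)

theorem RPunc.shift_neg_vec (g : RPunc T) : g.snd.shift (-g.vec) g.neg_vec_mem = g.fst :=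
  Subtype.ext (by
    change g.snd.1.translate (- -g.vec) = _
    rw [neg_neg, ← g.fst_eq])

theorem RPunc.exists_norm_vec_le {C : Set (RPunc T)} (hC : IsCompact C) :
    ∃ ρ : ℝ, 0 ≤ ρ ∧ ∀ a ∈ C, ‖a.vec‖ ≤ ρ := by
  obtain ⟨ρ, hρ⟩ := (hC.image RPunc.continuous_vec).isBounded.exists_norm_le
  exact ⟨max ρ 0, le_max_right _ _, fun a ha => (hρ _ ⟨a, ha, rfl⟩).trans (le_max_left _ _)⟩

theorem exists_centreMap_isInvariant (haper : T.IsAperiodic) (hrep : T.IsRepetitive)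
    {C : Set (RPunc T)} (hC : IsCompact C) {ε : ℝ} (hε : 0 < ε) :
    ∃ κ : CentreMap T, IsInvariant C ε (κ.subgroupoid haper).carrier := by
  classical
  obtain ⟨ρ, hρ, hCρ⟩ := RPunc.exists_norm_vec_le hC
  -- The separation `R` does not depend on the covering radius `R₁` of the centres, so it can be
  -- fixed before the centre map is chosen.
  obtain ⟨R, hR, hbd⟩ := exists_sep_boundary_lt (E := EuclideanSpace ℝ (Fin d)) P.inr_pos
    P.outr_pos.le hρ hε
  obtain ⟨κ, D, R₁, hκ⟩ := exists_centreMap haper hrep hR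
  refine ⟨κ, fun u => ?_⟩
  set S := u.1.fst with hS
  obtain ⟨hD, hDR, hnear⟩ := hκ S
  -- The centre of the cell of `p`, in the coordinates of `S`; the value `0` off the punctures is
  -- never used.
  set f : EuclideanSpace ℝ (Fin d) → EuclideanSpace ℝ (Fin d) := fun p =>
    if hp : p ∈ S.1.puncts then κ.centre (S.shift p hp) + p else 0 with hf
  have hfp : ∀ p (hp : p ∈ S.1.puncts), f p = κ.centre (S.shift p hp) + p := fun p hp =>
    dif_pos hp
  have hfg : ∀ g : RPunc T, g.snd = S → f (-g.vec) = κ.centre g.fst - g.vec := by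
    intro g hg
    have := g.neg_vec_mem
    rw [hg] at this
    rw [hfp _ this, sub_eq_add_neg]
    congr 2
    rw [← g.shift_neg_vec]
    congr 1
    exact hg.symm
  have hf0 : f 0 = κ.centre S := by
    rw [hfp 0 S.zero_mem_puncts, add_zero]
    congr 1
    exact Subtype.ext (by
      change S.1.translate (-0) = _
      rw [neg_zero, Tiling.translate_zero])
  have hfD : ∀ p ∈ S.1.puncts, f p ∈ D S ∧ ∀ q ∈ D S, ‖f p - p‖ ≤ ‖q - p‖ := by
    intro p hp
    rw [hfp p hp]
    exact hnear p hp
  obtain ⟨hfin, hne, hbfin, hlt⟩ := hbd S.1.puncts (D S) f R₁ S.1.pairwiseSep_puncts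
    S.1.exists_punct_near hD hDR hfD (κ.centre S) (hf0 ▸ (hfD 0 S.zero_mem_puncts).1)
  set cell := {p ∈ S.1.puncts | f p = κ.centre S} with hcell
  have hsrc : ∀ g : RPunc T, srcMap g = u ↔ g.snd = S := fun g =>
    ⟨fun h => congrArg (fun v => v.1.fst) h, fun h => Subtype.ext
      (RPunc.ext h (h.trans (congrArg RPunc.fst u.2).symm))⟩
  have hmem : ∀ g : RPunc T, g.snd = S →
      (g ∈ (κ.subgroupoid haper).carrier ↔ f (-g.vec) = κ.centre S) := by
    intro g hg
    rw [hfg g hg, κ.mem_subgroupoid, hg, sub_eq_iff_eq_add, eq_comm]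
  have hpunct : ∀ g : RPunc T, g.snd = S → -g.vec ∈ S.1.puncts := fun g hg => hg ▸ g.neg_vec_mem
  set A := fiber (κ.subgroupoid haper).carrier u with hA
  have hAS : A ⊆ {g | g.snd = S} := fun g hg => (hsrc g).1 hg.2
  have himage : (fun g : RPunc T => -g.vec) '' A = cell := by
    ext p
    constructor
    · rintro ⟨g, hg, rfl⟩
      exact ⟨hpunct g (hAS hg), (hmem g (hAS hg)).1 hg.1⟩
    · rintro ⟨hp, hpc⟩
      have hs : (inv (RPunc.arrow S p hp)).snd = S := rfl
      have hv : -(inv (RPunc.arrow S p hp)).vec = p := by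
        rw [RPunc.vec_inv haper, neg_neg, RPunc.vec_arrow haper]
      exact ⟨_, ⟨(hmem _ hs).2 (by rw [hv, hpc]), (hsrc _).2 hs⟩, hv⟩
  have hAfin : A.Finite := by
    rw [← himage] at hfin
    exact hfin.of_finite_image ((RPunc.injOn_neg_vec S).mono hAS)
  have hAcard : A.ncard = cell.ncard := by
    rw [← himage, ((RPunc.injOn_neg_vec S).mono hAS).ncard_image]
  have hmul : setMul C A ⊆ {g | g.snd = S} := by
    rintro _ ⟨a, _, b, hb, _, rfl⟩
    exact (hAS hb : b.snd = S)
  -- Additivity of `vec`: multiplying `b` on the left by `a ∈ C` moves the puncture `-b.vec` of the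
  -- cell by `-a.vec`, of norm at most `ρ`.
  have hmaps : MapsTo (fun g : RPunc T => -g.vec) (setMul C A \ A)
      {q ∈ S.1.puncts | f q ≠ κ.centre S ∧
        ∃ p ∈ S.1.puncts, f p = κ.centre S ∧ ‖q - p‖ ≤ ρ} := by
    intro g hg
    have hgS := hmul hg.1
    refine ⟨hpunct g hgS, fun h => hg.2 ⟨(hmem g hgS).2 h, (hsrc g).2 hgS⟩, ?_⟩
    obtain ⟨a, ha, b, hb, hab, rfl⟩ := hg.1
    refine ⟨-b.vec, hpunct b (hAS hb), (hmem b (hAS hb)).1 hb.1, ?_⟩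
    change ‖-(mul a b hab).vec - -b.vec‖ ≤ ρ
    rw [RPunc.vec_mul haper]
    have e : -(a.vec + b.vec) - -b.vec = -a.vec := by abel
    rw [e, norm_neg]
    exact hCρ a ha
  have hinj : InjOn (fun g : RPunc T => -g.vec) (setMul C A \ A) :=
    (RPunc.injOn_neg_vec S).mono (sdiff_subset.trans hmul)
  have hdfin : (setMul C A \ A).Finite := Set.Finite.of_injOn hmaps hinj hbfin
  refine ⟨hAfin, ?_, (hAfin.union hdfin).subset fun g hg => ?_, ?_⟩
  · rw [← himage] at hne
    exact hne.of_image
  · by_cases h : g ∈ A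
    · exact Or.inl h
    · exact Or.inr ⟨hg, h⟩
  · have hpos : (0 : ℝ) < cell.ncard := by exact_mod_cast (ncard_pos hfin).2 hne
    rw [hAcard, div_lt_iff₀ hpos]
    refine lt_of_le_of_lt ?_ hlt
    exact_mod_cast ncard_le_ncard_of_injOn _ hmaps hinj hbfin

end Tiling
end TilingGroupoid

theorem mainTheorem6 {d : ℕ} {ι : Type*} [Finite ι] (P : PrototileSet d ι) (T : Tiling P)
    (haper : T.IsAperiodic) (hrep : T.IsRepetitive) (hflc : T.HasFLC) :
    IsAlmostFinite (RPunc T) ∧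
      ∀ C : Set (RPunc T), IsCompact C → ∀ ε : ℝ, 0 < ε → ∀ δ : ℝ, 0 < δ →
        ∃ K : Subgroupoid (RPunc T), K.IsElementary ∧ IsInvariant C ε K.carrier ∧
          ∃ Φ : FundamentalDecomposition K.carrier, ∀ i j,
            Metric.ediam (unitTiling K '' Φ.F i j) < ENNReal.ofReal δ := by
  have key : ∀ C : Set (RPunc T), IsCompact C → ∀ ε : ℝ, 0 < ε → ∀ δ : ℝ, 0 < δ →
      ∃ K : Subgroupoid (RPunc T), K.IsElementary ∧ IsInvariant C ε K.carrier ∧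
        ∃ Φ : FundamentalDecomposition K.carrier, ∀ i j,
          Metric.ediam (unitTiling K '' Φ.F i j) < ENNReal.ofReal δ := by
    intro C hC ε hε δ hδ
    obtain ⟨κ, hκ⟩ := exists_centreMap_isInvariant haper hrep hC hε
    exact ⟨κ.subgroupoid haper, κ.isElementary haper hflc, hκ,
      κ.exists_decomposition_ediam_lt haper hflc hδ⟩
  refine ⟨⟨RPunc.isLCHEtale haper hflc, RPunc.exists_compact_open_gset haper hflc,
    fun C hC ε hε => ?_⟩, key⟩
  obtain ⟨K, hK, hinv, -⟩ := key C hC ε hε 1 one_pos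
  exact ⟨K, hK, hinv⟩
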